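/- Let $n\ge 2$ and let $\mathbb{Q}[\mathfrak{S}_n]$ be the rational group algebra of the symmetric group, with product induced by composition $(\alpha\beta)(i)=\alpha(\beta(i))$. Write $\sigma\in\mathfrak{S}_n$ as the word $\sigma_1\cdots\sigma_n$ with $\sigma_i=\sigma(i)$, and set $\sigma_0=0$. An alternating run of $\sigma$ is a maximal monotone sequence of consecutive entries of $\sigma_1\cdots\sigma_n$, and a left run is a maximal monotone sequence of consecutive entries of $\sigma_0\sigma_1\cdots\sigma_n$; let $\mathrm{run}(\sigma)$ and $\mathrm{run}^\circ(\sigma)$ be their numbers. Let $\mathrm{pk}(\sigma)$, resp. $\mathrm{pk}^\circ(\sigma)$, be the number of $i$ with $2\le i\le n-1$, resp. $1\le i\le n-1$, such that $\sigma_{i-1}<\sigma_i>\sigma_{i+1}$. The descent set of $\sigma$ is $\mathrm{Des}(\sigma)=\{i: 1\le i\le n-1,\ \sigma_i>\sigma_{i+1}\}$. Let $W_k^+$, resp. $W_k^-$, be the sum in $\mathbb{Q}[\mathfrak{S}_n]$ of all $\sigma$ with $\mathrm{run}(\sigma)=k$ whose first run is ascending, resp. descending, and let $W_k$, $W_k^\circ$,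 $P_k$, $P_k^\circ$ be the sums of all $\sigma$ with $\mathrm{run}(\sigma)=k$, $\mathrm{run}^\circ(\sigma)=k$, $\mathrm{pk}(\sigma)=k$, $\mathrm{pk}^\circ(\sigma)=k$, respectively. Consider the following linear subspaces of $\mathbb{Q}[\mathfrak{S}_n]$: \begin{align*} \mathcal{D}_n &= \mathrm{span}\Big(\textstyle\sum_{\mathrm{Des}(\sigma)=I}\sigma : I\subseteq\{1,\dots,n-1\}\Big) \quad\text{(the descent algebra)},\\ \mathcal{W}_n^{\pm} &= \mathrm{span}(W_k^+,\,W_k^- : 1\le k\le n-1),\\ \mathcal{W}_n &= \mathrm{span}(W_k : 1\le k\le n-1) \quad\text{(the reduced turning algebra)},\\ \mathcal{W}_n^\circ &= \mathrm{span}(W_k^\circ : 1\le k\le n) \quad\text{(the turning algebra)},\\ \mathcal{C}_n &= \mathrm{span}(W_{2k} : 1\le k\le\lfloor\tfrac{n-1}{2}\rfloor)+\mathrm{span}(W_{2k-1}^+,\,W_{2k-1}^- : 1\le k\le\lfloor\tfrac n2\rfloor),\\ \mathcal{P}_n &= \mathrm{span}(P_k : 0\le k\le\lfloor\tfrac{n-1}{2}\rfloor)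 \quad\text{(the Eulerian peak algebra)},\\ \mathcal{P}_n^\circ &= \mathrm{span}(P_k^\circ : 0\le k\le\lfloor\tfrac n2\rfloor) \quad\text{(the Eulerian left peak algebra)}. \end{align*} Then $\mathcal{D}_n$ is a unital subalgebra of $\mathbb{Q}[\mathfrak{S}_n]$, $\mathcal{W}_n^{\pm}$ is a unital subalgebra of $\mathcal{D}_n$, the spaces $\mathcal{W}_n^\circ$, $\mathcal{C}_n$ and $\mathcal{P}_n^\circ$ are unital subalgebras of $\mathcal{W}_n^{\pm}$, and $\mathcal{W}_n$ and $\mathcal{P}_n$ are subalgebras of $\mathcal{W}_n^{\pm}$ in the nonunital sense, i.e. linear subspaces closed under multiplication. -/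

import Mathlib

/-- The word of `σ` with 1-based positions and values: `oneLine σ i = σ(i)` for `1 ≤ i ≤ n`.
Outside this range the value is `0`; in particular `σ(0) = 0`. -/
def oneLine {n : ℕ} (σ : Equiv.Perm (Fin n)) (i : ℕ) : ℕ :=
  if h : 1 ≤ i ∧ i ≤ n then (σ ⟨i - 1, by omega⟩ : ℕ) + 1 else 0

/-- The factor `w a, …, w b` of the word `w` is monotone (increasing or decreasing). -/
def IsMonotoneFactor (w : ℕ → ℕ) (a b : ℕ) : Prop :=
  StrictMonoOn w (Set.Icc a b) ∨ StrictAntiOn w (Set.Icc a b)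

/-- `w a, …, w b` is a maximal monotone factor of the word `w lo, …, w hi`. -/
def IsRun (w : ℕ → ℕ) (lo hi a b : ℕ) : Prop :=
  (lo ≤ a ∧ a ≤ b ∧ b ≤ hi) ∧ IsMonotoneFactor w a b ∧
    ∀ c d, lo ≤ c → c ≤ a → b ≤ d → d ≤ hi → IsMonotoneFactor w c d → c = a ∧ d = b

/-- The number of maximal monotone factors of the word `w lo, …, w hi`. -/
noncomputable def numRuns (w : ℕ → ℕ) (lo hi : ℕ) : ℕ :=
  {p : ℕ × ℕ | IsRun w lo hi p.1 p.2}.ncard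

/-- The number of alternating runs of `σ(1), …, σ(n)`. -/
noncomputable def run {n : ℕ} (σ : Equiv.Perm (Fin n)) : ℕ := numRuns (oneLine σ) 1 n

/-- The number of left runs, i.e. alternating runs of `0, σ(1), …, σ(n)`. -/
noncomputable def leftRun {n : ℕ} (σ : Equiv.Perm (Fin n)) : ℕ := numRuns (oneLine σ) 0 n

/-- The first alternating run of `σ` is ascending. -/
def FirstRunAscending {n : ℕ} (σ : Equiv.Perm (Fin n)) : Prop :=
  ∃ b, IsRun (oneLine σ) 1 n 1 b ∧ StrictMonoOn (oneLine σ) (Set.Icc 1 b)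

/-- The first alternating run of `σ` is descending. -/
def FirstRunDescending {n : ℕ} (σ : Equiv.Perm (Fin n)) : Prop :=
  ∃ b, IsRun (oneLine σ) 1 n 1 b ∧ StrictAntiOn (oneLine σ) (Set.Icc 1 b)

/-- The descent set of `σ`, a subset of `{1, …, n-1}`. -/
def descentSet {n : ℕ} (σ : Equiv.Perm (Fin n)) : Finset ℕ :=
  {i ∈ Finset.Icc 1 (n - 1) | oneLine σ (i + 1) < oneLine σ i}

/-- The number of peaks, at positions `2 ≤ i ≤ n - 1`. -/
def numPeaks {n : ℕ} (σ : Equiv.Perm (Fin n)) : ℕ :=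
  (Finset.filter (fun i => oneLine σ (i - 1) < oneLine σ i ∧ oneLine σ (i + 1) < oneLine σ i)
    (Finset.Icc 2 (n - 1))).card

/-- The number of left peaks, at positions `1 ≤ i ≤ n - 1`, where `σ(0) = 0`. -/
def numLeftPeaks {n : ℕ} (σ : Equiv.Perm (Fin n)) : ℕ :=
  (Finset.filter (fun i => oneLine σ (i - 1) < oneLine σ i ∧ oneLine σ (i + 1) < oneLine σ i)
    (Finset.Icc 1 (n - 1))).card

/-- The rational group algebra of the symmetric group; `σ * τ` is the composition `σ ∘ τ`. -/
abbrev PermAlg (n : ℕ) : Type := MonoidAlgebra ℚ (Equiv.Perm (Fin n))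

open Classical in
/-- The sum, in the group algebra, of all permutations that satisfy `p`. -/
noncomputable def permSum {n : ℕ} (p : Equiv.Perm (Fin n) → Prop) : PermAlg n :=
  ∑ σ ∈ Finset.univ.filter p, MonoidAlgebra.of ℚ (Equiv.Perm (Fin n)) σ

/-- The sum of the permutations with descent set `I`. -/
noncomputable def descentSum (n : ℕ) (I : Finset ℕ) : PermAlg n :=
  permSum fun σ => descentSet σ = I

/-- `W_k^+`. -/
noncomputable def runSumAsc (n k : ℕ) : PermAlg n :=
  permSum fun σ => run σ = k ∧ FirstRunAscending σ

/-- `W_k^-`. -/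
noncomputable def runSumDesc (n k : ℕ) : PermAlg n :=
  permSum fun σ => run σ = k ∧ FirstRunDescending σ

/-- `W_k`. -/
noncomputable def runSum (n k : ℕ) : PermAlg n := permSum fun σ => run σ = k

/-- `W_k^∘`. -/
noncomputable def leftRunSum (n k : ℕ) : PermAlg n := permSum fun σ => leftRun σ = k

/-- `P_k`. -/
noncomputable def peakSum (n k : ℕ) : PermAlg n := permSum fun σ => numPeaks σ = k

/-- `P_k^∘`. -/
noncomputable def leftPeakSum (n k : ℕ) : PermAlg n := permSum fun σ => numLeftPeaks σ = k

/-- `𝒟_n`, as a linear subspace; the descent classes are indexed by the subsets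
of `{1, …, n-1}`. -/
noncomputable def descentSpace (n : ℕ) : Submodule ℚ (PermAlg n) :=
  Submodule.span ℚ (descentSum n '' {I | I ⊆ Finset.Icc 1 (n - 1)})

/-- `𝒲_n^±`. -/
noncomputable def signedRunSpace (n : ℕ) : Submodule ℚ (PermAlg n) :=
  Submodule.span ℚ (runSumAsc n '' Set.Icc 1 (n - 1) ∪ runSumDesc n '' Set.Icc 1 (n - 1))

/-- `𝒲_n`, the space of the reduced turning algebra. -/
noncomputable def runSpace (n : ℕ) : Submodule ℚ (PermAlg n) :=
  Submodule.span ℚ (runSum n '' Set.Icc 1 (n - 1))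

/-- `𝒲_n^∘`, the space of the turning algebra. -/
noncomputable def leftRunSpace (n : ℕ) : Submodule ℚ (PermAlg n) :=
  Submodule.span ℚ (leftRunSum n '' Set.Icc 1 n)

/-- `𝒞_n`, spanned by the `W_{2k}` and the `W_{2k-1}^±`. -/
noncomputable def cSpace (n : ℕ) : Submodule ℚ (PermAlg n) :=
  Submodule.span ℚ ((fun k => runSum n (2 * k)) '' Set.Icc 1 ((n - 1) / 2)) ⊔
    Submodule.span ℚ ((fun k => runSumAsc n (2 * k - 1)) '' Set.Icc 1 (n / 2) ∪
      (fun k => runSumDesc n (2 * k - 1)) '' Set.Icc 1 (n / 2))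

/-- `𝒫_n`, the space of the Eulerian peak algebra. -/
noncomputable def peakSpace (n : ℕ) : Submodule ℚ (PermAlg n) :=
  Submodule.span ℚ (peakSum n '' Set.Icc 0 ((n - 1) / 2))

/-- `𝒫_n^∘`, the space of the Eulerian left peak algebra. -/
noncomputable def leftPeakSpace (n : ℕ) : Submodule ℚ (PermAlg n) :=
  Submodule.span ℚ (leftPeakSum n '' Set.Icc 0 (n / 2))

/-! ### Functions of a permutation statistic and triangular spanning sets -/

section StatSpace

variable {n : ℕ} {κ : Type*}

/-! Each of the seven spaces consists of the elements whose coefficients depend only on some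
statistic of permutations (`statSpace`). Closure under multiplication is invisible on the fibre
sums, so each space is given another spanning set, on which products are explicit.

These spanning sets come from words over signed alphabets. Standardizing a word lists its positions
by letter, equal letters being read forwards or backwards according to the sign of the letter.
Standardizations of two words multiply to the standardization of a word over the product alphabet
(`standardize_mul`), provided the blocks of negative letters are reversed. For an alternating
alphabet with `a` letters and first sign `s`, let `altSum n a s` be the sum over all words. The
twisted product of two alternating alphabets is again alternating, so the product of two such sums
is a third one (`altSum_mul`).

The coefficient of `σ` in `altSum n a s` counts the weakly increasing words compatible with the
ascents and descents of `σ`. With `m = n - 1` and `c` the number of sign changes in `s` followed by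
these directions, the generating function in `a` is `X/(1-X)^2 * ((1+X^2)/(1-X^2))^m *
(2X/(1+X^2))^c` (`compatibleSeries_eq`). So the coefficient depends on `c` alone and vanishes
exactly until `a = c + 1`. Its odd part in `X` sees only `⌈c/2⌉`, its even part only `⌊c/2⌋`. For
`s` positive, `c + 1` is the number of left runs and `⌈c/2⌉` that of left peaks; for `s` negative,
`⌊c/2⌋` is the number of peaks; adding both signs leaves the number of runs. Triangularity
(`span_eq_statSpace_of_triangular`) then identifies the spans of suitable families of `altSum`s with
six of the spaces, and `altSum_mul` shows that they are closed. For the descent algebra, all letters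
are positive and the words carry rearrangement-invariant weights. -/

theorem coeff_permSum (p : Equiv.Perm (Fin n) → Prop) [DecidablePred p] (σ : Equiv.Perm (Fin n)) :
    (permSum p).coeff σ = if p σ then 1 else 0 := by
  classical
  simp [permSum, Finsupp.single_apply, MonoidAlgebra.coeff_sum, Finsupp.finsetSum_apply]

/-- The elements of the group algebra whose coefficients depend only on the statistic `st`. -/
def statSpace (st : Equiv.Perm (Fin n) → κ) : Submodule ℚ (PermAlg n) where
  carrier := {x | ∀ σ τ, st σ = st τ → x.coeff σ = x.coeff τ}
  zero_mem' := by simp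
  add_mem' := by
    intro x y hx hy σ τ h
    simp [hx σ τ h, hy σ τ h]
  smul_mem' := by
    intro c x hx σ τ h
    simp [hx σ τ h]

theorem statSpace_le {κ' : Type*} {st : Equiv.Perm (Fin n) → κ} {st' : Equiv.Perm (Fin n) → κ'}
    (h : ∀ σ τ, st σ = st τ → st' σ = st' τ) : statSpace st' ≤ statSpace st :=
  fun _ hx σ τ hst => hx σ τ (h σ τ hst)

/-- An element of `statSpace st` is a combination of the sums over the fibres of `st`. -/
theorem eq_sum_fiber {st : Equiv.Perm (Fin n) → κ} {x : PermAlg n} (hx : x ∈ statSpace st) :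
    ∃ (s : Finset (Equiv.Perm (Fin n))), Set.InjOn st s ∧ (∀ τ, ∃ σ ∈ s, st σ = st τ) ∧
      x = ∑ σ ∈ s, x.coeff σ • permSum (fun τ => st τ = st σ) := by
  classical
  obtain ⟨s, -, hs, hinj⟩ := Finset.exists_subset_injOn_image_eq_of_surjOn
    (f := st) (s := (Finset.univ : Finset (Equiv.Perm (Fin n))))
    (t := Finset.univ.image st) (by intro k hk; simpa using hk)
  have hcov : ∀ τ, ∃ σ ∈ s, st σ = st τ := by
    intro τ
    have : st τ ∈ s.image st := by rw [hinj]; simp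
    simpa using this
  refine ⟨s, hs, hcov, ?_⟩
  ext τ
  obtain ⟨σ, hσs, hσ⟩ := hcov τ
  rw [MonoidAlgebra.coeff_sum, Finsupp.finsetSum_apply, Finset.sum_eq_single_of_mem σ hσs]
  · rw [MonoidAlgebra.coeff_smul_apply, coeff_permSum, if_pos hσ.symm, hx τ σ hσ.symm]
    simp
  · intro ρ hρs hρ
    rw [MonoidAlgebra.coeff_smul_apply, coeff_permSum, if_neg, smul_zero]
    exact fun h => hρ (hs hρs hσs (h.symm.trans hσ.symm))

theorem span_eq_statSpace (st : Equiv.Perm (Fin n) → κ) (G : Set (PermAlg n))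
    (hG : ∀ g ∈ G, g ∈ statSpace st) (hmem : ∀ σ, permSum (fun τ => st τ = st σ) ∈ G) :
    Submodule.span ℚ G = statSpace st := by
  apply le_antisymm (Submodule.span_le.2 hG)
  intro x hx
  obtain ⟨s, -, -, h⟩ := eq_sum_fiber hx
  rw [h]
  exact Submodule.sum_mem _ fun σ _ => Submodule.smul_mem _ _ (Submodule.subset_span (hmem σ))

/-- A family that is triangular with respect to the fibre sums of `st` spans `statSpace st`. -/
theorem span_eq_statSpace_of_triangular (st : Equiv.Perm (Fin n) → κ) (rk : κ → ℕ)
    (S : Set (PermAlg n)) (hS : ∀ x ∈ S, x ∈ statSpace st)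
    (htri : ∀ σ, ∃ x ∈ S, x.coeff σ ≠ 0 ∧
      ∀ τ, x.coeff τ ≠ 0 → st τ = st σ ∨ rk (st τ) < rk (st σ)) :
    Submodule.span ℚ S = statSpace st := by
  classical
  -- Induction on the rank: subtracting from `x` its fibre sums of smaller rank leaves a nonzero
  -- multiple of the fibre sum of `σ`.
  have key : ∀ N σ, rk (st σ) < N → permSum (fun τ => st τ = st σ) ∈ Submodule.span ℚ S := by
    intro N
    induction N with
    | zero => intro σ h; omega
    | succ N ih =>
      intro σ hσ
      obtain ⟨x, hxS, hxσ, hx⟩ := htri σ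
      obtain ⟨s, hinj, hcov, hsum⟩ := eq_sum_fiber (hS x hxS)
      obtain ⟨σ', hσ's, hσ'⟩ := hcov σ
      rw [← Finset.add_sum_erase _ _ hσ's] at hsum
      have hc : x.coeff σ' = x.coeff σ := hS x hxS _ _ hσ'
      have hrest : ∑ τ ∈ s.erase σ', x.coeff τ • permSum (fun τ' => st τ' = st τ) ∈
          Submodule.span ℚ S := by
        refine Submodule.sum_mem _ fun τ hτ => ?_
        by_cases h0 : x.coeff τ = 0
        · simp [h0]
        · refine Submodule.smul_mem _ _ (ih τ ?_)
          rw [Finset.mem_erase] at hτ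
          rcases hx τ h0 with h | h
          · exact absurd (hinj hτ.2 hσ's (h.trans hσ'.symm)) hτ.1
          · omega
      have : permSum (fun τ => st τ = st σ) = (x.coeff σ)⁻¹ •
          (x - ∑ τ ∈ s.erase σ', x.coeff τ • permSum (fun τ' => st τ' = st τ)) := by
        rw [eq_inv_smul_iff₀ hxσ, eq_sub_iff_add_eq, ← hc, ← hσ', ← hsum]
      rw [this]
      exact Submodule.smul_mem _ _ (Submodule.sub_mem _ (Submodule.subset_span hxS) hrest)
  apply le_antisymm (Submodule.span_le.2 hS)
  intro x hx
  obtain ⟨s, -, -, h⟩ := eq_sum_fiber hx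
  rw [h]
  exact Submodule.sum_mem _ fun σ _ => Submodule.smul_mem _ _ (key _ σ (Nat.lt_succ_self _))

theorem mul_mem_span {A : Type*} [Semiring A] [Algebra ℚ A] {S : Set A}
    (h : ∀ x ∈ S, ∀ y ∈ S, x * y ∈ Submodule.span ℚ S) {x y : A}
    (hx : x ∈ Submodule.span ℚ S) (hy : y ∈ Submodule.span ℚ S) :
    x * y ∈ Submodule.span ℚ S := by
  have : Submodule.span ℚ S * Submodule.span ℚ S ≤ Submodule.span ℚ S := by
    rw [Submodule.span_mul_span, Submodule.span_le]
    rintro _ ⟨x, hx, y, hy, rfl⟩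
    exact h x hx y hy
  exact this (Submodule.mul_mem_mul hx hy)

end StatSpace

/-! ### Words over signed alphabets and their standardizations -/

section Standardization

/-- The order in which standardization reads the positions of the word `w`: by letter, and then
from left to right for a letter of positive sign, from right to left otherwise. -/
def sortKey {n a : ℕ} (sg : Fin a → Bool) (w : Fin n → Fin a) (i : Fin n) : Fin a ×ₗ ℤ :=
  toLex (w i, if sg (w i) then (i : ℤ) else -(i : ℤ))

/-- The permutation that lists the positions of `w` in the order of `sortKey`. -/
def standardize {n a : ℕ} (sg : Fin a → Bool) (w : Fin n → Fin a) : Equiv.Perm (Fin n) :=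
  Tuple.sort (sortKey sg w)

theorem sortKey_lt_iff {n a : ℕ} (sg : Fin a → Bool) (w : Fin n → Fin a) (i j : Fin n) :
    sortKey sg w i < sortKey sg w j ↔
      w i < w j ∨ (w i = w j ∧ if sg (w i) then i < j else j < i) := by
  rw [sortKey, sortKey, Prod.Lex.toLex_lt_toLex]
  refine or_congr Iff.rfl (and_congr_right fun h => ?_)
  simp only at h
  rw [← h]
  cases sg (w i) <;> simp

theorem sortKey_injective {n a : ℕ} (sg : Fin a → Bool) (w : Fin n → Fin a) :
    Function.Injective (sortKey sg w) := by
  intro i j h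
  by_contra hne
  have h1 := (sortKey_lt_iff sg w i j).not.1 h.not_lt
  have h2 := (sortKey_lt_iff sg w j i).not.1 h.not_gt
  push Not at h1 h2
  have hw : w i = w j := le_antisymm h2.1 h1.1
  have h3 := h1.2 hw
  have h4 := h2.2 hw.symm
  rw [hw] at h3
  cases hs : sg (w j) <;> (simp [hs] at h3 h4; omega)

theorem standardize_eq_iff {n a : ℕ} (sg : Fin a → Bool) (w : Fin n → Fin a)
    (σ : Equiv.Perm (Fin n)) :
    standardize sg w = σ ↔ StrictMono (sortKey sg w ∘ σ) := by
  rw [standardize, eq_comm, Tuple.eq_sort_iff]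
  constructor
  · exact fun h => h.1.strictMono_of_injective ((sortKey_injective sg w).comp σ.injective)
  · exact fun h => ⟨h.monotone, fun i j hij he => absurd he (h hij).ne⟩

theorem strictMono_sortKey_standardize {n a : ℕ} (sg : Fin a → Bool) (w : Fin n → Fin a) :
    StrictMono (sortKey sg w ∘ standardize sg w) :=
  (standardize_eq_iff sg w _).1 rfl

/-- The sum of the standardizations of all words of length `n` over the signed alphabet
`Fin a`, with weights `φ`. -/
noncomputable def wordSum {n a : ℕ} (sg : Fin a → Bool) (φ : (Fin n → Fin a) → ℚ) : PermAlg n :=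
  ∑ w, φ w • MonoidAlgebra.of ℚ (Equiv.Perm (Fin n)) (standardize sg w)

/-- The alphabet `Fin b × Fin a` in lexicographic order, where the second component is read
backwards when the sign of the first is negative. -/
def twistedProdEquiv {b a : ℕ} (sgb : Fin b → Bool) : Fin b × Fin a ≃ Fin (b * a) :=
  (Equiv.prodShear (Equiv.refl (Fin b))
    fun y => if sgb y then Equiv.refl (Fin a) else Fin.revPerm).trans finProdFinEquiv

theorem twistedProdEquiv_val {b a : ℕ} (sgb : Fin b → Bool) (y : Fin b) (x : Fin a) :
    (twistedProdEquiv sgb (y, x) : ℕ) = (if sgb y then (x : ℕ) else a - 1 - x) + a * y := by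
  simp only [twistedProdEquiv, Equiv.trans_apply, Equiv.prodShear_apply, Equiv.refl_apply,
    finProdFinEquiv_apply_val]
  cases sgb y
  · simp [Fin.val_rev]
    omega
  · simp

theorem twistedProdEquiv_lt_iff {b a : ℕ} (sgb : Fin b → Bool) (y y' : Fin b) (x x' : Fin a) :
    twistedProdEquiv sgb (y, x) < twistedProdEquiv sgb (y', x') ↔
      y < y' ∨ (y = y' ∧ if sgb y then x < x' else x' < x) := by
  rw [Fin.lt_def, twistedProdEquiv_val, twistedProdEquiv_val]
  have key : ∀ {u u' p q : ℕ}, u < a → u' < a → p < q → u + a * p < u' + a * q := by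
    intro u u' p q hu hu' h
    have : a * (p + 1) ≤ a * q := Nat.mul_le_mul_left _ h
    nlinarith
  have hb : ∀ (z : Fin b) (x : Fin a), (if sgb z then (x : ℕ) else a - 1 - x) < a := by
    intro z x
    split_ifs <;> omega
  rcases lt_trichotomy y y' with h | h | h
  · exact iff_of_true (key (hb _ _) (hb _ _) h) (Or.inl h)
  · subst h
    cases sgb y
    · simp
      omega
    · simp
  · refine iff_of_false (not_lt.2 (key (hb _ _) (hb _ _) h).le) ?_
    rintro (h' | ⟨h', -⟩)
    · exact lt_asymm h h'
    · exact h.ne h'.symm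

/-- The product of the standardizations of two words is the standardization of a word over the
product alphabet. -/
theorem standardize_mul {n a b : ℕ} (sga : Fin a → Bool) (sgb : Fin b → Bool)
    (sg : Fin (b * a) → Bool)
    (hsg : ∀ y x, sg (twistedProdEquiv sgb (y, x)) = (sgb y == sga x))
    (w : Fin n → Fin a) (v : Fin n → Fin b) :
    standardize sga w * standardize sgb (v ∘ standardize sga w) =
      standardize sg (fun i => twistedProdEquiv sgb (v i, w i)) := by
  symm
  rw [standardize_eq_iff]
  have hw := strictMono_sortKey_standardize sga w
  have hv := strictMono_sortKey_standardize sgb (v ∘ standardize sga w)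
  set σ := standardize sga w
  set τ := standardize sgb (v ∘ σ)
  intro i j hij
  have h1 := hv hij
  simp only [Function.comp_apply, sortKey_lt_iff, Equiv.Perm.mul_apply] at h1 ⊢
  rw [twistedProdEquiv_lt_iff, hsg, (twistedProdEquiv sgb).apply_eq_iff_eq, Prod.mk.injEq]
  rcases h1 with h1 | ⟨h1, h2⟩
  · exact Or.inl (Or.inl h1)
  · cases hs : sgb (v (σ (τ i)))
    -- At a negative letter of `v`, `τ` reads backwards the list that `σ` has sorted by `w`. This
    -- reverses the order of the letters of `w` and the reading direction of equal ones, whence the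
    -- reversed block and the product sign.
    · simp only [hs] at h2
      have h3 := hw (show τ j < τ i by simpa using h2)
      simp only [Function.comp_apply, sortKey_lt_iff] at h3
      rcases h3 with h3 | ⟨h3, h4⟩
      · exact Or.inl (Or.inr ⟨h1, by simpa using h3⟩)
      · refine Or.inr ⟨⟨h1, h3.symm⟩, ?_⟩
        rw [h3] at h4
        cases hs' : sga (w (σ (τ i))) <;> simpa [hs'] using h4
    · simp only [hs] at h2
      have h3 := hw (show τ i < τ j by simpa using h2)
      simp only [Function.comp_apply, sortKey_lt_iff] at h3
      rcases h3 with h3 | ⟨h3, h4⟩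
      · exact Or.inl (Or.inr ⟨h1, by simpa using h3⟩)
      · refine Or.inr ⟨⟨h1, h3⟩, ?_⟩
        cases hs' : sga (w (σ (τ i))) <;> simpa [hs'] using h4

/-- The second factor in `standardize_mul` is the standardization of `v` rearranged by the first;
invariance of `ψ` under rearrangement makes this change of variable harmless. -/
theorem wordSum_mul {n a b : ℕ} (sga : Fin a → Bool) (sgb : Fin b → Bool)
    (sg : Fin (b * a) → Bool)
    (hsg : ∀ y x, sg (twistedProdEquiv sgb (y, x)) = (sgb y == sga x))
    (φ : (Fin n → Fin a) → ℚ) (ψ : (Fin n → Fin b) → ℚ)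
    (hψ : ∀ v (π : Equiv.Perm (Fin n)), ψ (v ∘ π) = ψ v) :
    wordSum sga φ * wordSum sgb ψ = wordSum sg fun u : Fin n → Fin (b * a) =>
      φ (fun i => ((twistedProdEquiv sgb).symm (u i)).2) *
        ψ (fun i => ((twistedProdEquiv sgb).symm (u i)).1) := by
  simp only [wordSum, Finset.sum_mul_sum]
  have h1 : ∀ w : Fin n → Fin a,
      (∑ v : Fin n → Fin b, (φ w • MonoidAlgebra.of ℚ (Equiv.Perm (Fin n)) (standardize sga w)) *
        (ψ v • MonoidAlgebra.of ℚ (Equiv.Perm (Fin n)) (standardize sgb v))) =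
      ∑ v : Fin n → Fin b, (φ w * ψ v) • MonoidAlgebra.of ℚ (Equiv.Perm (Fin n))
        (standardize sg (fun i => twistedProdEquiv sgb (v i, w i))) := by
    intro w
    rw [← (Equiv.arrowCongr (standardize sga w).symm (Equiv.refl (Fin b))).sum_comp]
    refine Finset.sum_congr rfl fun v _ => ?_
    have : Equiv.arrowCongr (standardize sga w).symm (Equiv.refl (Fin b)) v =
        v ∘ standardize sga w := by
      ext; simp
    rw [this, hψ, smul_mul_smul_comm, ← map_mul, standardize_mul sga sgb sg hsg]
  rw [Finset.sum_congr rfl fun w _ => h1 w, ← Finset.sum_product']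
  let e : (Fin n → Fin a) × (Fin n → Fin b) ≃ (Fin n → Fin (b * a)) :=
    ((Equiv.prodComm _ _).trans (Equiv.arrowProdEquivProdArrow (Fin n) (fun _ => Fin b)
      (fun _ => Fin a)).symm).trans (Equiv.arrowCongr (Equiv.refl _) (twistedProdEquiv sgb))
  rw [← e.sum_comp]
  refine Finset.sum_congr rfl fun p _ => ?_
  have : e p = fun i => twistedProdEquiv sgb (p.2 i, p.1 i) := by
    ext i; simp [e, Equiv.arrowProdEquivProdArrow]
  simp [this]

/-- `f` is weakly increasing, and takes the same value at `i` and `i + 1` only if the sign of this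
value is `d i`. -/
def IsCompatible {m a : ℕ} (sg : Fin a → Bool) (d : Fin m → Bool) (f : Fin (m + 1) → Fin a) :
    Prop :=
  ∀ i : Fin m, f i.castSucc < f i.succ ∨ (f i.castSucc = f i.succ ∧ sg (f i.castSucc) = d i)

instance {m a : ℕ} (sg : Fin a → Bool) (d : Fin m → Bool) (f : Fin (m + 1) → Fin a) :
    Decidable (IsCompatible sg d f) := by
  unfold IsCompatible; infer_instance

/-- The ascents (`true`) and descents (`false`) of a permutation. -/
def directions {m : ℕ} (σ : Equiv.Perm (Fin (m + 1))) (i : Fin m) : Bool :=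
  decide (σ i.castSucc < σ i.succ)

/-- A word with standardization `σ` becomes weakly increasing when read along `σ`, and a repeated
letter must have the sign of the direction in which `σ` moves there. -/
theorem standardize_comp_symm_eq_iff {m a : ℕ} (sg : Fin a → Bool) (f : Fin (m + 1) → Fin a)
    (σ : Equiv.Perm (Fin (m + 1))) :
    standardize sg (f ∘ σ.symm) = σ ↔ IsCompatible sg (directions σ) f := by
  rw [standardize_eq_iff, Fin.strictMono_iff_lt_succ]
  refine forall_congr' fun i => ?_
  have hne : σ i.castSucc ≠ σ i.succ := σ.injective.ne (Fin.castSucc_lt_succ).ne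
  simp only [Function.comp_apply, sortKey_lt_iff, Equiv.symm_apply_apply, directions]
  refine or_congr Iff.rfl (and_congr_right fun _ => ?_)
  cases sg (f i.castSucc) <;> simp [le_iff_lt_or_eq, hne.symm]

theorem coeff_wordSum {m a : ℕ} (sg : Fin a → Bool) (φ : (Fin (m + 1) → Fin a) → ℚ)
    (hφ : ∀ v (π : Equiv.Perm (Fin (m + 1))), φ (v ∘ π) = φ v) (σ : Equiv.Perm (Fin (m + 1))) :
    (wordSum sg φ).coeff σ = ∑ f with IsCompatible sg (directions σ) f, φ f := by
  classical
  rw [wordSum, MonoidAlgebra.coeff_sum, Finsupp.finsetSum_apply, Finset.sum_filter,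
    ← (Equiv.arrowCongr σ (Equiv.refl (Fin a))).sum_comp]
  refine Finset.sum_congr rfl fun f _ => ?_
  have : Equiv.arrowCongr σ (Equiv.refl (Fin a)) f = f ∘ σ.symm := by
    ext; simp
  rw [this, hφ, MonoidAlgebra.coeff_smul_apply, MonoidAlgebra.of_apply,
    MonoidAlgebra.coeff_single, Finsupp.single_apply]
  simp [standardize_comp_symm_eq_iff]

end Standardization

/-! ### Counting compatible words over alternating alphabets -/

section Alternating

/-- The alternating signs `s, -s, s, …`. -/
def altSign (s : Bool) {a : ℕ} (c : Fin a) : Bool := xor s (Nat.bodd c)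

/-- The number of compatible words over the alternating alphabet of size `a`. -/
def numCompatible {m : ℕ} (d : Fin m → Bool) (s : Bool) (a : ℕ) : ℕ :=
  Finset.card {f : Fin (m + 1) → Fin a | IsCompatible (altSign s) d f}

/-- The number of changes of sign in the sequence `s, d 0, …, d (m - 1)`. -/
def numChanges : {m : ℕ} → (Fin m → Bool) → Bool → ℕ
  | 0, _, _ => 0
  | _ + 1, d, s => (if d 0 = s then 0 else 1) + numChanges (Fin.tail d) (d 0)

theorem numCompatible_zero {m : ℕ} (d : Fin m → Bool) (s : Bool) : numCompatible d s 0 = 0 := by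
  rw [numCompatible, Finset.card_eq_zero]
  ext f
  exact (f 0).elim0

theorem numCompatible_of_length_zero (d : Fin 0 → Bool) (s : Bool) (a : ℕ) :
    numCompatible d s a = a := by
  have : ∀ f : Fin (0 + 1) → Fin a, IsCompatible (altSign s) d f := fun f i => i.elim0
  simp [numCompatible, this]

theorem IsCompatible.monotone {m a : ℕ} {sg : Fin a → Bool} {d : Fin m → Bool}
    {f : Fin (m + 1) → Fin a} (h : IsCompatible sg d f) : Monotone f :=
  Fin.monotone_iff_le_succ.2 fun i => (h i).elim le_of_lt fun h => h.1.le

theorem altSign_succ (s : Bool) {a : ℕ} (c : Fin a) : altSign s c.succ = altSign (!s) c := by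
  simp [altSign]

theorem isCompatible_succ_comp {m a : ℕ} (s : Bool) (d : Fin m → Bool) (f : Fin (m + 1) → Fin a) :
    IsCompatible (altSign s) d (Fin.succ ∘ f) ↔ IsCompatible (altSign (!s)) d f := by
  simp [IsCompatible, altSign_succ]

/-- A compatible word is weakly increasing, so if it does not begin with the least letter it avoids
that letter. Deleting the letter from the alphabet flips the initial sign. -/
theorem card_compatible_ne_zero {m : ℕ} (d : Fin m → Bool) (s : Bool) (a : ℕ) :
    Finset.card {f : Fin (m + 1) → Fin (a + 1) | IsCompatible (altSign s) d f ∧ f 0 ≠ 0} =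
      numCompatible d (!s) a := by
  symm
  refine Finset.card_bij (fun f _ => Fin.succ ∘ f) ?_ ?_ ?_
  · intro f hf
    simp only [Finset.mem_filter, Finset.mem_univ, true_and] at hf ⊢
    exact ⟨(isCompatible_succ_comp s d f).2 hf, Fin.succ_ne_zero _⟩
  · intro f _ g _ h
    exact (Fin.succ_injective a).comp_left h
  · intro f hf
    simp only [Finset.mem_filter, Finset.mem_univ, true_and] at hf
    have h0 : ∀ i, f i ≠ 0 := fun i h =>
      hf.2 (Fin.le_zero_iff.1 (h ▸ hf.1.monotone (Fin.zero_le i)))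
    have hf' : Fin.succ ∘ (fun i => (f i).pred (h0 i)) = f := by ext i; simp
    refine ⟨fun i => (f i).pred (h0 i), ?_, hf'⟩
    simp only [Finset.mem_filter, Finset.mem_univ, true_and]
    rw [← isCompatible_succ_comp, hf']
    exact hf.1

theorem isCompatible_cons {m a : ℕ} (sg : Fin a → Bool) (d : Fin (m + 1) → Bool) (c : Fin a)
    (g : Fin (m + 1) → Fin a) :
    IsCompatible sg d (Fin.cons c g) ↔
      (c < g 0 ∨ (c = g 0 ∧ sg c = d 0)) ∧ IsCompatible sg (Fin.tail d) g := by
  rw [IsCompatible, Fin.forall_fin_succ]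
  rfl

/-- Split by whether the word begins with the least letter, whose sign is `s`. If it does, that
letter may be repeated when `d 0 = s`; otherwise the tail avoids it. -/
theorem numCompatible_succ {m : ℕ} (d : Fin (m + 1) → Bool) (s : Bool) (a : ℕ) :
    numCompatible d s (a + 1) = numCompatible d (!s) a +
      if d 0 = s then numCompatible (Fin.tail d) s (a + 1)
      else numCompatible (Fin.tail d) (!s) a := by
  have hsplit : numCompatible d s (a + 1) =
      Finset.card {f : Fin (m + 2) → Fin (a + 1) | IsCompatible (altSign s) d f ∧ f 0 ≠ 0} +
      Finset.card {f : Fin (m + 2) → Fin (a + 1) | IsCompatible (altSign s) d f ∧ f 0 = 0} := by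
    rw [numCompatible, ← Finset.card_filter_add_card_filter_not (fun f => f 0 ≠ 0),
      Finset.filter_filter, Finset.filter_filter]
    simp
  have htail : Finset.card {f : Fin (m + 2) → Fin (a + 1) |
      IsCompatible (altSign s) d f ∧ f 0 = 0} = Finset.card {g : Fin (m + 1) → Fin (a + 1) |
        (0 < g 0 ∨ (0 = g 0 ∧ s = d 0)) ∧ IsCompatible (altSign s) (Fin.tail d) g} := by
    have h0 : altSign s (0 : Fin (a + 1)) = s := by simp [altSign]
    symm
    refine Finset.card_bij (fun g _ => Fin.cons 0 g) ?_ ?_ ?_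
    · intro g hg
      simp only [Finset.mem_filter, Finset.mem_univ, true_and] at hg ⊢
      refine ⟨(isCompatible_cons _ _ _ _).2 ?_, rfl⟩
      rwa [h0]
    · intro f _ g _ h
      exact Fin.cons_right_injective _ h
    · intro f hf
      simp only [Finset.mem_filter, Finset.mem_univ, true_and] at hf
      have hc : Fin.cons 0 (Fin.tail f) = f := by
        rw [← hf.2]; exact Fin.cons_self_tail f
      refine ⟨Fin.tail f, ?_, hc⟩
      simp only [Finset.mem_filter, Finset.mem_univ, true_and]
      have := hf.1
      rwa [← hc, isCompatible_cons, h0] at this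
  rw [hsplit, htail, card_compatible_ne_zero]
  congr 1
  split_ifs with h
  · rw [numCompatible]
    congr 1
    ext g
    have : (0 < g 0 ∨ (0 = g 0 ∧ s = d 0)) := by
      rcases (Fin.zero_le (g 0)).lt_or_eq with h' | h'
      · exact Or.inl h'
      · exact Or.inr ⟨h', h.symm⟩
    simp [this]
  · rw [← card_compatible_ne_zero]
    congr 1
    ext g
    have : ¬ s = d 0 := fun h' => h h'.symm
    simp [this, and_comm, Fin.pos_iff_ne_zero]

open PowerSeries

/-- The generating function of `numCompatible`. -/
noncomputable def compatibleSeries {m : ℕ} (d : Fin m → Bool) (s : Bool) : ℚ⟦X⟧ :=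
  PowerSeries.mk fun a => (numCompatible d s a : ℚ)

theorem compatibleSeries_succ {m : ℕ} (d : Fin (m + 1) → Bool) (s : Bool) :
    compatibleSeries d s = X * compatibleSeries d (!s) +
      if d 0 = s then compatibleSeries (Fin.tail d) s
      else X * compatibleSeries (Fin.tail d) (!s) := by
  ext a
  cases a with
  | zero =>
    split_ifs <;> simp [compatibleSeries, numCompatible_zero]
  | succ a =>
    split_ifs with h <;> simp [compatibleSeries, coeff_succ_X_mul, numCompatible_succ, h]

/-- The recursions for the two initial signs form a linear system with determinant `1 - X ^ 2`. Both
involve the same tail series, the one with initial sign `d 0`. -/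
theorem one_sub_X_sq_mul_compatibleSeries {m : ℕ} (d : Fin (m + 1) → Bool) (s : Bool) :
    (1 - X ^ 2) * compatibleSeries d s =
      if d 0 = s then (1 + X ^ 2) * compatibleSeries (Fin.tail d) (d 0)
      else 2 * X * compatibleSeries (Fin.tail d) (d 0) := by
  have h1 := compatibleSeries_succ d (d 0)
  have h2 := compatibleSeries_succ d (!d 0)
  simp only [if_true, Bool.not_not, Bool.eq_not_self, if_false] at h1 h2
  split_ifs with h
  · rw [← h]
    linear_combination h1 + X * h2
  · have : s = !d 0 := by cases s <;> cases hd : d 0 <;> simp_all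
    rw [this]
    linear_combination h2 + X * h1

/-- Each direction contributes a factor `(1+X^2)/(1-X^2)` if it repeats the previous sign and
`2X/(1-X^2)` if it changes it; the empty sequence gives `X/(1-X)^2`. -/
theorem compatibleSeries_eq {m : ℕ} (d : Fin m → Bool) (s : Bool) :
    (1 - X ^ 2) ^ m * (1 - X) ^ 2 * (1 + X ^ 2) ^ numChanges d s * compatibleSeries d s =
      X * (1 + X ^ 2) ^ m * (2 * X) ^ numChanges d s := by
  induction m generalizing s with
  | zero =>
    have : compatibleSeries d s = PowerSeries.mk fun a => (a : ℚ) := by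
      ext a; simp [compatibleSeries, numCompatible_of_length_zero]
    simp only [numChanges, pow_zero, one_mul, mul_one, this]
    have h1 : (1 - X) * (PowerSeries.mk fun a => (a : ℚ)) = X * PowerSeries.mk 1 := by
      ext a
      cases a with
      | zero => simp [sub_mul]
      | succ a => simp [sub_mul, coeff_succ_X_mul]
    have h2 : (1 - X : ℚ⟦X⟧) * PowerSeries.mk 1 = 1 := by
      rw [mul_comm]; exact PowerSeries.mk_one_mul_one_sub_eq_one ℚ
    linear_combination (1 - X) * h1 + X * h2
  | succ m ih =>
    have h1 := one_sub_X_sq_mul_compatibleSeries d s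
    have h2 := ih (Fin.tail d) (d 0)
    rw [numChanges]
    split_ifs at h1 ⊢ with h
    · rw [zero_add]
      linear_combination (1 - X ^ 2) ^ m * (1 - X) ^ 2 *
        (1 + X ^ 2) ^ numChanges (Fin.tail d) (d 0) * h1 + (1 + X ^ 2) * h2
    · rw [pow_add, pow_add, pow_one, pow_one]
      linear_combination (1 - X ^ 2) ^ m * (1 - X) ^ 2 *
        (1 + X ^ 2) ^ numChanges (Fin.tail d) (d 0) * (1 + X ^ 2) * h1 +
        (1 + X ^ 2) * (2 * X) * h2

theorem ne_zero_of_constantCoeff_eq_one {φ : ℚ⟦X⟧} (h : constantCoeff φ = 1) : φ ≠ 0 := by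
  rintro rfl
  simp at h

theorem numCompatible_congr {m : ℕ} {d d' : Fin m → Bool} {s s' : Bool}
    (h : numChanges d s = numChanges d' s') (a : ℕ) :
    numCompatible d s a = numCompatible d' s' a := by
  have h1 := compatibleSeries_eq d s
  rw [h, ← compatibleSeries_eq d' s'] at h1
  have h2 := mul_left_cancel₀ (ne_zero_of_constantCoeff_eq_one (by simp)) h1
  have h3 := congrArg (PowerSeries.coeff a) h2
  simpa [compatibleSeries] using h3

/-- All other factors of the closed form have constant coefficient `1`, hence are invertible. The
order and leading coefficient found here yield the triangularity. -/
theorem exists_compatibleSeries_eq {m : ℕ} (d : Fin m → Bool) (s : Bool) :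
    ∃ Q : ℚ⟦X⟧, compatibleSeries d s = X ^ (numChanges d s + 1) * Q ∧
      constantCoeff Q = 2 ^ numChanges d s := by
  have h1 := compatibleSeries_eq d s
  set U : ℚ⟦X⟧ := (1 - X ^ 2) ^ m * (1 - X) ^ 2 * (1 + X ^ 2) ^ numChanges d s with hU
  have hU1 : constantCoeff U = 1 := by simp [hU]
  obtain ⟨V, hV⟩ := (PowerSeries.isUnit_iff_constantCoeff.2 (hU1 ▸ isUnit_one)).exists_right_inv
  have hV1 : constantCoeff V = 1 := by
    have := congrArg constantCoeff hV
    simpa [hU1] using this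
  refine ⟨V * ((1 + X ^ 2) ^ m * 2 ^ numChanges d s), ?_, ?_⟩
  · rw [mul_pow] at h1
    linear_combination V * h1 - compatibleSeries d s * hV
  · have h2 : constantCoeff (2 : ℚ⟦X⟧) = 2 := map_ofNat _ 2
    simp [hV1, h2]

theorem numCompatible_eq_zero {m : ℕ} (d : Fin m → Bool) (s : Bool) {a : ℕ}
    (h : a ≤ numChanges d s) : numCompatible d s a = 0 := by
  obtain ⟨Q, hQ, -⟩ := exists_compatibleSeries_eq d s
  have := congrArg (PowerSeries.coeff a) hQ
  rw [PowerSeries.coeff_X_pow_mul', if_neg (by omega)] at this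
  simpa [compatibleSeries] using this

theorem numCompatible_ne_zero {m : ℕ} (d : Fin m → Bool) (s : Bool) :
    numCompatible d s (numChanges d s + 1) ≠ 0 := by
  obtain ⟨Q, hQ, hQ1⟩ := exists_compatibleSeries_eq d s
  have := congrArg (PowerSeries.coeff (numChanges d s + 1)) hQ
  rw [PowerSeries.coeff_X_pow_mul', if_pos le_rfl, Nat.sub_self,
    PowerSeries.coeff_zero_eq_constantCoeff_apply, hQ1] at this
  intro h0
  simp only [compatibleSeries, coeff_mk, h0, Nat.cast_zero] at this
  exact pow_ne_zero _ two_ne_zero this.symm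

theorem numCompatible_le_succ {m : ℕ} (d : Fin m → Bool) (s : Bool) (a : ℕ) :
    numCompatible d s a ≤ numCompatible d s (a + 1) := by
  refine Finset.card_le_card_of_injOn (fun f => Fin.castSucc ∘ f) ?_ ?_
  · intro f hf
    rw [Finset.mem_coe, Finset.mem_filter] at hf ⊢
    exact ⟨Finset.mem_univ _, fun i => by simpa [altSign] using hf.2 i⟩
  · intro f _ g _ h
    exact (Fin.castSucc_injective a).comp_left h

theorem evalNeg_compatibleSeries_eq {m : ℕ} (d : Fin m → Bool) (s : Bool) :
    (1 - X ^ 2) ^ m * (1 + X) ^ 2 * (1 + X ^ 2) ^ numChanges d s *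
      evalNegHom (compatibleSeries d s) =
      -X * (1 + X ^ 2) ^ m * (-(2 * X)) ^ numChanges d s := by
  have h := congrArg evalNegHom (compatibleSeries_eq d s)
  have h2 : evalNegHom (2 : ℚ⟦X⟧) = 2 := map_ofNat _ 2
  simpa [h2, evalNegHom_X] using h

theorem coeff_evalNegHom (φ : ℚ⟦X⟧) (a : ℕ) :
    PowerSeries.coeff a (evalNegHom φ) = (-1) ^ a * PowerSeries.coeff a φ := by
  simp [evalNegHom, PowerSeries.coeff_rescale]

/-- The odd parts of `X/(1-X)^2` and of `X/(1-X)^2 * 2X/(1+X^2)` differ by the factor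
`(2X/(1+X^2))^2`, since the even part of the former is `2X^2/(1-X^2)^2` and its odd part
`X(1+X^2)/(1-X^2)^2`. Hence `c = 2k - 1` and `c = 2k` give the same odd part. -/
theorem numCompatible_congr_of_odd {m : ℕ} {d d' : Fin m → Bool} {s s' : Bool} {a : ℕ}
    (ha : Odd a) (h : (numChanges d s + 1) / 2 = (numChanges d' s' + 1) / 2) :
    numCompatible d s a = numCompatible d' s' a := by
  have key : ∀ (d : Fin m → Bool) (s : Bool) (k : ℕ), (numChanges d s + 1) / 2 = k →
      (1 - X ^ 2) ^ (m + 2) * (1 + X ^ 2) ^ (2 * k) *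
        (compatibleSeries d s - evalNegHom (compatibleSeries d s)) =
        2 * X * (1 + X ^ 2) ^ (m + 1) * (2 * X) ^ (2 * k) := by
    intro d s k hk
    have h1 := compatibleSeries_eq d s
    have h2 := evalNeg_compatibleSeries_eq d s
    rcases Nat.even_or_odd (numChanges d s) with hc | hc
    · rw [hc.neg_pow] at h2
      have : numChanges d s = 2 * k := by obtain ⟨r, hr⟩ := hc; omega
      rw [this] at h1 h2
      linear_combination (1 + X) ^ 2 * h1 - (1 - X) ^ 2 * h2
    · rw [hc.neg_pow] at h2
      have : 2 * k = numChanges d s + 1 := by obtain ⟨r, hr⟩ := hc; omega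
      rw [this]
      linear_combination (1 + X ^ 2) * (1 + X) ^ 2 * h1 - (1 + X ^ 2) * (1 - X) ^ 2 * h2
  have h1 := key d s _ rfl
  rw [h, ← key d' s' _ rfl] at h1
  have h2 := mul_left_cancel₀ (ne_zero_of_constantCoeff_eq_one (by simp)) h1
  have h3 := congrArg (PowerSeries.coeff a) h2
  simp only [map_sub, coeff_evalNegHom, ha.neg_one_pow, compatibleSeries, coeff_mk] at h3
  have h4 : (numCompatible d s a : ℚ) = numCompatible d' s' a := by linarith
  exact_mod_cast h4

/-- As for odd `a`, with the even part of the series: now `c = 2k` and `c = 2k + 1` agree. -/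
theorem numCompatible_congr_of_even {m : ℕ} {d d' : Fin m → Bool} {s s' : Bool} {a : ℕ}
    (ha : Even a) (h : numChanges d s / 2 = numChanges d' s' / 2) :
    numCompatible d s a = numCompatible d' s' a := by
  have key : ∀ (d : Fin m → Bool) (s : Bool) (k : ℕ), numChanges d s / 2 = k →
      (1 - X ^ 2) ^ (m + 2) * (1 + X ^ 2) ^ (2 * k + 1) *
        (compatibleSeries d s + evalNegHom (compatibleSeries d s)) =
        2 * X * (1 + X ^ 2) ^ (m + 1) * (2 * X) ^ (2 * k + 1) := by
    intro d s k hk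
    have h1 := compatibleSeries_eq d s
    have h2 := evalNeg_compatibleSeries_eq d s
    rcases Nat.even_or_odd (numChanges d s) with hc | hc
    · rw [hc.neg_pow] at h2
      have : numChanges d s = 2 * k := by obtain ⟨r, hr⟩ := hc; omega
      rw [this] at h1 h2
      linear_combination (1 + X ^ 2) * (1 + X) ^ 2 * h1 + (1 + X ^ 2) * (1 - X) ^ 2 * h2
    · rw [hc.neg_pow] at h2
      have : 2 * k + 1 = numChanges d s := by obtain ⟨r, hr⟩ := hc; omega
      rw [this]
      linear_combination (1 + X) ^ 2 * h1 + (1 - X) ^ 2 * h2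
  have h1 := key d s _ rfl
  rw [h, ← key d' s' _ rfl] at h1
  have h2 := mul_left_cancel₀ (ne_zero_of_constantCoeff_eq_one (by simp)) h1
  have h3 := congrArg (PowerSeries.coeff a) h2
  simp only [map_add, coeff_evalNegHom, ha.neg_one_pow, compatibleSeries, coeff_mk] at h3
  have h4 : (numCompatible d s a : ℚ) = numCompatible d' s' a := by linarith
  exact_mod_cast h4

end Alternating

/-! ### The multiplication rule for alternating alphabets -/

section AlternatingSum

/-- The sum of the standardizations of all words over the alternating alphabet `s, -s, s, …`
with `a` letters. -/
noncomputable def altSum (n a : ℕ) (s : Bool) : PermAlg n :=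
  wordSum (altSign s : Fin a → Bool) 1

theorem coeff_altSum {m : ℕ} (a : ℕ) (s : Bool) (σ : Equiv.Perm (Fin (m + 1))) :
    (altSum (m + 1) a s).coeff σ = numCompatible (directions σ) s a := by
  rw [altSum, coeff_wordSum _ _ (by simp)]
  simp [numCompatible]

theorem bodd_eq_false_iff_even (a : ℕ) : Nat.bodd a = false ↔ Even a := by
  rw [Nat.even_iff, Nat.mod_two_of_bodd]
  cases Nat.bodd a <;> simp

/-- Signs alternate inside each block. Reversing alternate blocks puts the same letter `x` on both
sides of a block boundary, where only the sign of `y` flips, so alternation persists. If `t` is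
negative, the first block starts at `x = a - 1`, which explains the role of the parity of `a` in the
first sign. -/
theorem altSum_mul (n a b : ℕ) (s t : Bool) :
    altSum n a s * altSum n b t = altSum n (b * a) (if Even a then s else s == t) := by
  rw [altSum, altSum, wordSum_mul (altSign s) (altSign t)
    (altSign (if Even a then s else s == t)) ?_ _ _ (by simp)]
  · rw [altSum]
    congr 1
    ext; simp
  · intro y x
    have hx := x.2
    have hr : Nat.bodd (a - 1 - x) = xor (Nat.bodd a) (!Nat.bodd x) := by
      have h1 : a = (a - 1 - x) + x + 1 := by omega
      have h2 := congrArg Nat.bodd h1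
      simp only [Nat.bodd_add, Nat.bodd_one] at h2
      rw [h2]
      cases Nat.bodd (a - 1 - x) <;> cases Nat.bodd x <;> rfl
    have hv : Nat.bodd (twistedProdEquiv (altSign t) (y, x)) =
        xor (bif altSign t y then Nat.bodd x else xor (Nat.bodd a) (!Nat.bodd x))
          (Nat.bodd a && Nat.bodd y) := by
      rw [twistedProdEquiv_val, Nat.bodd_add, Nat.bodd_mul]
      cases altSign t y <;> simp [hr]
    rw [altSign, hv]
    simp only [altSign, ← bodd_eq_false_iff_even]
    clear hv hr hx
    generalize Nat.bodd a = p, Nat.bodd x = q, Nat.bodd y = r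
    revert s t p q r
    decide

theorem altSum_one (n : ℕ) : altSum n 1 true = 1 := by
  have h : standardize (altSign true : Fin 1 → Bool) (fun _ => 0 : Fin n → Fin 1) = 1 := by
    rw [standardize_eq_iff]
    intro i j hij
    simp only [Function.comp_apply, sortKey_lt_iff]
    right
    simpa [altSign] using hij
  simp [altSum, wordSum, h, MonoidAlgebra.one_def]

end AlternatingSum

/-! ### Runs as factors between changes of direction -/

section Runs

/-- The word `w` ascends from position `i` to position `i + 1`. -/
def ascends (w : ℕ → ℕ) (i : ℕ) : Bool := decide (w i < w (i + 1))

variable {w : ℕ → ℕ} {lo hi : ℕ}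

theorem strictMonoOn_Icc_iff {a b : ℕ} :
    StrictMonoOn w (Set.Icc a b) ↔ ∀ i, a ≤ i → i < b → w i < w (i + 1) := by
  constructor
  · intro h i h1 h2
    exact h ⟨h1, h2.le⟩ ⟨by omega, h2⟩ (Nat.lt_succ_self i)
  · intro h
    apply strictMonoOn_of_lt_add_one Set.ordConnected_Icc
    intro i _ h1 h2
    exact h i h1.1 h2.2

theorem strictAntiOn_Icc_iff {a b : ℕ} :
    StrictAntiOn w (Set.Icc a b) ↔ ∀ i, a ≤ i → i < b → w (i + 1) < w i := by
  constructor
  · intro h i h1 h2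
    exact h ⟨h1, h2.le⟩ ⟨by omega, h2⟩ (Nat.lt_succ_self i)
  · intro h
    apply strictAntiOn_of_add_one_lt Set.ordConnected_Icc
    intro i _ h1 h2
    exact h i h1.1 h2.2

theorem isMonotoneFactor_iff (hw : ∀ i, lo ≤ i → i < hi → w i ≠ w (i + 1)) {a b : ℕ}
    (ha : lo ≤ a) (hb : b ≤ hi) :
    IsMonotoneFactor w a b ↔ ∀ i, a < i → i < b → ascends w (i - 1) = ascends w i := by
  rw [IsMonotoneFactor, strictMonoOn_Icc_iff, strictAntiOn_Icc_iff]
  constructor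
  · rintro (h | h) i h1 h2
    · have h3 := h (i - 1) (by omega) (by omega)
      have h4 := h i (by omega) (by omega)
      rw [Nat.sub_add_cancel (by omega)] at h3
      simp [ascends, Nat.sub_add_cancel (show 1 ≤ i by omega), h3, h4]
    · have h3 := h (i - 1) (by omega) (by omega)
      have h4 := h i (by omega) (by omega)
      rw [Nat.sub_add_cancel (by omega)] at h3
      simp [ascends, Nat.sub_add_cancel (show 1 ≤ i by omega), not_lt.2 h3.le, not_lt.2 h4.le]
  · intro h
    have hc : ∀ k, a + k < b → ascends w (a + k) = ascends w a := by
      intro k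
      induction k with
      | zero => intro _; rfl
      | succ k ih =>
        intro hk
        rw [← ih (by omega), ← h (a + (k + 1)) (by omega) hk]
        rfl
    cases hd : ascends w a
    · right
      intro i h1 h2
      obtain ⟨k, rfl⟩ := Nat.exists_eq_add_of_le h1
      have h3 := hc k h2
      rw [hd, ascends, decide_eq_false_iff_not] at h3
      exact lt_of_le_of_ne (not_lt.1 h3) (hw _ (by omega) (by omega)).symm
    · left
      intro i h1 h2
      obtain ⟨k, rfl⟩ := Nat.exists_eq_add_of_le h1
      have h3 := hc k h2
      rwa [hd, ascends, decide_eq_true_iff] at h3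

/-- A run is a factor between two consecutive changes of direction. -/
theorem isRun_iff (hlt : lo < hi) (hw : ∀ i, lo ≤ i → i < hi → w i ≠ w (i + 1)) {a b : ℕ} :
    IsRun w lo hi a b ↔ (lo ≤ a ∧ a < b ∧ b ≤ hi) ∧
      (∀ i, a < i → i < b → ascends w (i - 1) = ascends w i) ∧
      (a = lo ∨ ascends w (a - 1) ≠ ascends w a) ∧ (b = hi ∨ ascends w (b - 1) ≠ ascends w b) := by
  constructor
  · rintro ⟨⟨h1, h2, h3⟩, h4, h5⟩
    have hab : a < b := by
      rcases h2.lt_or_eq with h | rfl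
      · exact h
      exfalso
      -- A single letter is never a run: since `lo < hi`, it extends to a monotone factor of two
      -- letters on one side.
      by_cases ha : a < hi
      · have := h5 a (a + 1) h1 le_rfl (by omega) ha
          ((isMonotoneFactor_iff hw h1 ha).2 fun i _ _ => by omega)
        omega
      · have := h5 (a - 1) a (by omega) (by omega) le_rfl h3
          ((isMonotoneFactor_iff hw (by omega) h3).2 fun i _ _ => by omega)
        omega
    rw [isMonotoneFactor_iff hw h1 h3] at h4
    refine ⟨⟨h1, hab, h3⟩, h4, ?_, ?_⟩
    · by_contra! hcon
      have := h5 (a - 1) b (by omega) (by omega) le_rfl h3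
        ((isMonotoneFactor_iff hw (by omega) h3).2 fun i hi1 hi2 => by
          rcases (show a ≤ i by omega).lt_or_eq with h | rfl
          · exact h4 i h hi2
          · exact hcon.2)
      omega
    · by_contra! hcon
      have := h5 a (b + 1) h1 le_rfl (by omega) (by omega)
        ((isMonotoneFactor_iff hw h1 (by omega)).2 fun i hi1 hi2 => by
          rcases (show i ≤ b by omega).lt_or_eq with h | rfl
          · exact h4 i hi1 h
          · exact hcon.2)
      omega
  · rintro ⟨⟨h1, h2, h3⟩, h4, h5, h6⟩
    refine ⟨⟨h1, h2.le, h3⟩, (isMonotoneFactor_iff hw h1 h3).2 h4, ?_⟩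
    intro c d hc hca hbd hd hm
    rw [isMonotoneFactor_iff hw hc hd] at hm
    constructor
    · by_contra hne
      have h7 := hm a (by omega) (by omega)
      rcases h5 with h5 | h5
      · omega
      · exact h5 h7
    · by_contra hne
      have h7 := hm b (by omega) (by omega)
      rcases h6 with h6 | h6
      · omega
      · exact h6 h7

theorem exists_isRun (hlt : lo < hi) (hw : ∀ i, lo ≤ i → i < hi → w i ≠ w (i + 1)) {a : ℕ}
    (h1 : lo ≤ a) (h2 : a < hi) (h3 : a = lo ∨ ascends w (a - 1) ≠ ascends w a) :
    ∃ b, IsRun w lo hi a b := by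
  have hex : ∃ b, a < b ∧ (b = hi ∨ ascends w (b - 1) ≠ ascends w b) := ⟨hi, h2, Or.inl rfl⟩
  have hspec := Nat.find_spec hex
  refine ⟨Nat.find hex, (isRun_iff hlt hw).2 ⟨⟨h1, hspec.1, Nat.find_min' hex ⟨h2, Or.inl rfl⟩⟩,
    ?_, h3, hspec.2⟩⟩
  intro i hi1 hi2
  by_contra hne
  exact Nat.find_min hex hi2 ⟨hi1, Or.inr hne⟩

/-- A run is determined by its left end, which is either `lo` or an interior change of direction;
each of these occurs. -/
theorem numRuns_eq (hlt : lo < hi) (hw : ∀ i, lo ≤ i → i < hi → w i ≠ w (i + 1)) :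
    numRuns w lo hi = 1 + Finset.card {i ∈ Finset.Ioo lo hi | ascends w (i - 1) ≠ ascends w i} := by
  have hA : Prod.fst '' {p : ℕ × ℕ | IsRun w lo hi p.1 p.2} =
      ((insert lo {i ∈ Finset.Ioo lo hi | ascends w (i - 1) ≠ ascends w i} : Finset ℕ) : Set ℕ) := by
    ext a
    simp only [Set.mem_image, Set.mem_ofPred_eq, Prod.exists, exists_and_right, exists_eq_right,
      Finset.coe_insert, Finset.coe_filter, Finset.mem_Ioo, Set.mem_insert_iff]
    constructor
    · rintro ⟨b, hb⟩
      obtain ⟨⟨h1, h2, h3⟩, -, h5, -⟩ := (isRun_iff hlt hw).1 hb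
      rcases h5 with h5 | h5
      · exact Or.inl h5
      · rcases h1.lt_or_eq with h1 | h1
        · exact Or.inr ⟨⟨h1, by omega⟩, h5⟩
        · exact Or.inl h1.symm
    · rintro (rfl | ⟨⟨h1, h2⟩, h3⟩)
      · exact exists_isRun hlt hw le_rfl hlt (Or.inl rfl)
      · exact exists_isRun hlt hw h1.le h2 (Or.inr h3)
  have hinj : Set.InjOn Prod.fst {p : ℕ × ℕ | IsRun w lo hi p.1 p.2} := by
    rintro ⟨a, b⟩ hp ⟨a', b'⟩ hq (rfl : a = a')
    simp only [Set.mem_ofPred_eq, isRun_iff hlt hw] at hp hq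
    obtain ⟨⟨h1, h2, h3⟩, h4, -, h6⟩ := hp
    obtain ⟨⟨h1', h2', h3'⟩, h4', -, h6'⟩ := hq
    congr 1
    rcases lt_trichotomy b b' with h | h | h
    · exact absurd (h4' b h2 h) (h6.resolve_left (by omega))
    · exact h
    · exact absurd (h4 b' h2' h) (h6'.resolve_left (by omega))
  rw [numRuns, ← hinj.ncard_image, hA, Set.ncard_coe_finset,
    Finset.card_insert_of_notMem (by simp), add_comm]

end Runs

/-! ### Runs and peaks in terms of sign changes -/

section Statistics

theorem numChanges_eq_sum {m : ℕ} (e : ℕ → Bool) :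
    numChanges (fun i : Fin m => e (i + 1)) (e 0) =
      ∑ i ∈ Finset.range m, if e i ≠ e (i + 1) then 1 else 0 := by
  induction m generalizing e with
  | zero => simp [numChanges]
  | succ m ih =>
    rw [Finset.sum_range_succ', numChanges, add_comm]
    congr 1
    · exact ih fun i => e (i + 1)
    · simp [eq_comm]

/-- Changes from `true` to `false` alternate with changes back, so the two kinds are equinumerous up
to boundary terms. -/
theorem two_mul_sum_peaks (m : ℕ) (e : ℕ → Bool) :
    2 * (∑ i ∈ Finset.range m, if e i = true ∧ e (i + 1) = false then 1 else 0) + (e m).toNat =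
      (∑ i ∈ Finset.range m, if e i ≠ e (i + 1) then 1 else 0) + (e 0).toNat := by
  induction m with
  | zero => simp
  | succ m ih =>
    rw [Finset.sum_range_succ, Finset.sum_range_succ, mul_add]
    cases h1 : e m <;> cases h2 : e (m + 1) <;> simp_all <;> omega

theorem oneLine_succ {m : ℕ} (σ : Equiv.Perm (Fin (m + 1))) (i : ℕ) (hi : i < m + 1) :
    oneLine σ (i + 1) = σ ⟨i, hi⟩ + 1 := by
  simp [oneLine, Nat.lt_succ_iff.1 hi]

theorem oneLine_zero {m : ℕ} (σ : Equiv.Perm (Fin (m + 1))) : oneLine σ 0 = 0 := by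
  simp [oneLine]

theorem ascends_oneLine_succ {m : ℕ} (σ : Equiv.Perm (Fin (m + 1))) (i : Fin m) :
    ascends (oneLine σ) (i + 1) = directions σ i := by
  rw [ascends, oneLine_succ σ i (by omega), oneLine_succ σ (i + 1) (by omega), directions]
  simp only [add_lt_add_iff_right, ← Fin.lt_def]
  rfl

theorem ascends_oneLine_zero {m : ℕ} (σ : Equiv.Perm (Fin (m + 1))) :
    ascends (oneLine σ) 0 = true := by
  simp [ascends, oneLine_zero, oneLine_succ σ 0]

theorem oneLine_ne {m : ℕ} (σ : Equiv.Perm (Fin (m + 1))) {i : ℕ} (hi : i < m + 1) :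
    oneLine σ i ≠ oneLine σ (i + 1) := by
  cases i with
  | zero => simp [oneLine_zero, oneLine_succ σ 0]
  | succ i =>
    rw [oneLine_succ σ i (by omega), oneLine_succ σ (i + 1) hi]
    intro h
    have h2 := σ.injective (Fin.ext (Nat.succ_injective h))
    simp at h2

theorem ascends_oneLine_eq_false_iff {m : ℕ} (σ : Equiv.Perm (Fin (m + 1))) {i : ℕ}
    (hi : i < m + 1) :
    ascends (oneLine σ) i = false ↔ oneLine σ (i + 1) < oneLine σ i := by
  rw [ascends, decide_eq_false_iff_not, not_lt]
  exact ⟨fun h => lt_of_le_of_ne h (oneLine_ne σ hi).symm, le_of_lt⟩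

theorem card_filter_Ioo_eq_sum (p : ℕ → Prop) [DecidablePred p] (c m : ℕ) :
    Finset.card {i ∈ Finset.Ioo c (c + m + 1) | p i} =
      ∑ i ∈ Finset.range m, if p (c + 1 + i) then 1 else 0 := by
  rw [Finset.card_filter, show Finset.Ioo c (c + m + 1) = Finset.Ico (c + 1) (c + m + 1) from rfl,
    Finset.sum_Ico_eq_sum_range]
  congr 2
  omega

/-- The convention `σ(0) = 0` makes the word start with an ascent, which is the initial sign `true`.
-/
theorem leftRun_eq {m : ℕ} (σ : Equiv.Perm (Fin (m + 1))) :
    leftRun σ = 1 + numChanges (directions σ) true := by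
  have hd : directions σ = fun i : Fin m => ascends (oneLine σ) (i + 1) := by
    ext i; rw [ascends_oneLine_succ]
  rw [leftRun, numRuns_eq (w := oneLine σ) (Nat.succ_pos m) fun i _ hi => oneLine_ne σ hi,
    ← ascends_oneLine_zero σ, hd, numChanges_eq_sum]
  have := card_filter_Ioo_eq_sum
    (fun i => ascends (oneLine σ) (i - 1) ≠ ascends (oneLine σ) i) 0 m
  rw [zero_add] at this
  rw [this]
  simp [add_comm]

theorem run_eq {m : ℕ} (σ : Equiv.Perm (Fin (m + 2))) :
    run σ = 1 + numChanges (Fin.tail (directions σ)) (directions σ 0) := by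
  have hd : Fin.tail (directions σ) = fun i : Fin m => ascends (oneLine σ) (i + 1 + 1) := by
    ext i; rw [Fin.tail, ← ascends_oneLine_succ]; rfl
  have h0 : directions σ 0 = ascends (oneLine σ) (0 + 1) := by
    rw [← ascends_oneLine_succ]; rfl
  rw [run, numRuns_eq (w := oneLine σ) (by omega) fun i _ hi => oneLine_ne σ hi,
    hd, h0, numChanges_eq_sum fun i => ascends (oneLine σ) (i + 1)]
  have := card_filter_Ioo_eq_sum
    (fun i => ascends (oneLine σ) (i - 1) ≠ ascends (oneLine σ) i) 1 m
  rw [show 1 + m + 1 = m + 2 by omega] at this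
  rw [this]
  congr 1
  refine Finset.sum_congr rfl fun i _ => ?_
  rw [show 1 + 1 + i = i + 1 + 1 by omega, Nat.add_sub_cancel]

theorem numChanges_directions {m : ℕ} (σ : Equiv.Perm (Fin (m + 2))) (s : Bool) :
    numChanges (directions σ) s + 1 = run σ + if directions σ 0 = s then 0 else 1 := by
  rw [run_eq, numChanges]
  omega

/-- After the initial ascent the changes go down, up, down, …; the left peaks are the first, third,
… of them. -/
theorem numLeftPeaks_eq {m : ℕ} (σ : Equiv.Perm (Fin (m + 1))) :
    numLeftPeaks σ = (numChanges (directions σ) true + 1) / 2 := by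
  have hd : directions σ = fun i : Fin m => ascends (oneLine σ) (i + 1) := by
    ext i; rw [ascends_oneLine_succ]
  have hs : numLeftPeaks σ = ∑ i ∈ Finset.range m,
      if ascends (oneLine σ) i = true ∧ ascends (oneLine σ) (i + 1) = false then 1 else 0 := by
    rw [numLeftPeaks, Finset.card_filter, Nat.add_sub_cancel,
      show Finset.Icc 1 m = Finset.Ico 1 (m + 1) from rfl, Finset.sum_Ico_eq_sum_range]
    refine Finset.sum_congr rfl fun i hi => ?_
    rw [Finset.mem_range] at hi
    refine if_congr ?_ rfl rfl
    rw [ascends_oneLine_eq_false_iff σ (by omega), ascends, decide_eq_true_iff, add_comm 1 i,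
      Nat.add_sub_cancel]
  have h := two_mul_sum_peaks m (ascends (oneLine σ))
  rw [← hs, ← numChanges_eq_sum, ← hd, ascends_oneLine_zero] at h
  have := Bool.toNat_le (ascends (oneLine σ) m)
  simp only [Bool.toNat_true] at h
  omega

/-- With a fictitious initial descent the changes go up, down, up, …; the peaks are the second,
fourth, … of them. -/
theorem numPeaks_eq {m : ℕ} (σ : Equiv.Perm (Fin (m + 2))) :
    numPeaks σ = numChanges (directions σ) false / 2 := by
  have hd : Fin.tail (directions σ) = fun i : Fin m => ascends (oneLine σ) (i + 1 + 1) := by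
    ext i; rw [Fin.tail, ← ascends_oneLine_succ]; rfl
  have h0 : directions σ 0 = ascends (oneLine σ) (0 + 1) := by
    rw [← ascends_oneLine_succ]; rfl
  have hs : numPeaks σ = ∑ i ∈ Finset.range m, if ascends (oneLine σ) (i + 1) = true ∧
      ascends (oneLine σ) (i + 1 + 1) = false then 1 else 0 := by
    rw [numPeaks, Finset.card_filter, show m + 2 - 1 = m + 1 from rfl,
      show Finset.Icc 2 (m + 1) = Finset.Ico 2 (m + 2) from rfl, Finset.sum_Ico_eq_sum_range]
    refine Finset.sum_congr rfl fun i hi => ?_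
    rw [Finset.mem_range] at hi
    refine if_congr ?_ rfl rfl
    rw [ascends_oneLine_eq_false_iff σ (by omega), ascends, decide_eq_true_iff,
      show 2 + i = i + 1 + 1 by omega, Nat.add_sub_cancel]
  have h := two_mul_sum_peaks m fun i => ascends (oneLine σ) (i + 1)
  rw [← hs, ← numChanges_eq_sum fun i => ascends (oneLine σ) (i + 1), ← hd, ← h0] at h
  have := Bool.toNat_le (ascends (oneLine σ) (m + 1))
  rw [numChanges]
  cases hb : directions σ 0 <;> simp only [hb, Bool.toNat_true, Bool.toNat_false] at h ⊢ <;>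
    simp <;> omega

theorem numChanges_le {m : ℕ} (d : Fin m → Bool) (s : Bool) : numChanges d s ≤ m := by
  induction m generalizing s with
  | zero => rfl
  | succ m ih =>
    have := ih (Fin.tail d) (d 0)
    rw [numChanges]
    split_ifs <;> omega

theorem exists_isRun_oneLine {m : ℕ} (σ : Equiv.Perm (Fin (m + 2))) :
    ∃ b, 1 < b ∧ IsRun (oneLine σ) 1 (m + 2) 1 b := by
  have hw : ∀ i, 1 ≤ i → i < m + 2 → oneLine σ i ≠ oneLine σ (i + 1) :=
    fun i _ hi => oneLine_ne σ hi
  obtain ⟨b, hb⟩ := exists_isRun (by omega) hw le_rfl (by omega) (Or.inl rfl)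
  exact ⟨b, ((isRun_iff (by omega) hw).1 hb).1.2.1, hb⟩

theorem one_lt_of_isRun {m b : ℕ} {σ : Equiv.Perm (Fin (m + 2))}
    (hb : IsRun (oneLine σ) 1 (m + 2) 1 b) : 1 < b :=
  ((isRun_iff (w := oneLine σ) (by omega) fun i _ hi => oneLine_ne σ hi).1 hb).1.2.1

theorem directions_zero {m : ℕ} (σ : Equiv.Perm (Fin (m + 2))) :
    directions σ 0 = decide (oneLine σ 1 < oneLine σ 2) := by
  rw [← ascends_oneLine_succ]; rfl

theorem firstRunAscending_iff {m : ℕ} (σ : Equiv.Perm (Fin (m + 2))) :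
    FirstRunAscending σ ↔ directions σ 0 = true := by
  rw [directions_zero, decide_eq_true_iff]
  constructor
  · rintro ⟨b, hb, h⟩
    exact strictMonoOn_Icc_iff.1 h 1 le_rfl (one_lt_of_isRun hb)
  · intro h
    obtain ⟨b, hb1, hb⟩ := exists_isRun_oneLine σ
    refine ⟨b, hb, hb.2.1.resolve_right fun h' => ?_⟩
    exact lt_asymm h (strictAntiOn_Icc_iff.1 h' 1 le_rfl hb1)

theorem firstRunDescending_iff {m : ℕ} (σ : Equiv.Perm (Fin (m + 2))) :
    FirstRunDescending σ ↔ directions σ 0 = false := by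
  rw [directions_zero, decide_eq_false_iff_not, not_lt]
  constructor
  · rintro ⟨b, hb, h⟩
    exact (strictAntiOn_Icc_iff.1 h 1 le_rfl (one_lt_of_isRun hb)).le
  · intro h
    obtain ⟨b, hb1, hb⟩ := exists_isRun_oneLine σ
    refine ⟨b, hb, hb.2.1.resolve_left fun h' => ?_⟩
    exact absurd (strictMonoOn_Icc_iff.1 h' 1 le_rfl hb1) (not_lt.2 h)

theorem descentSet_eq_iff {m : ℕ} (σ τ : Equiv.Perm (Fin (m + 1))) :
    descentSet σ = descentSet τ ↔ directions σ = directions τ := by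
  have key : ∀ (ρ : Equiv.Perm (Fin (m + 1))) (i : Fin m),
      ((i : ℕ) + 1 ∈ descentSet ρ) ↔ directions ρ i = false := by
    intro ρ i
    rw [← ascends_oneLine_succ, ascends_oneLine_eq_false_iff ρ (by omega), descentSet,
      Finset.mem_filter, Finset.mem_Icc]
    exact and_iff_right (by omega)
  constructor
  · intro h
    ext i
    have h1 := key σ i
    rw [h, key τ i] at h1
    revert h1
    cases directions σ i <;> cases directions τ i <;> simp
  · intro h
    ext i
    by_cases hi : 1 ≤ i ∧ i ≤ m
    · have h1 := key σ ⟨i - 1, by omega⟩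
      rw [h, ← key τ] at h1
      simpa [Nat.sub_add_cancel hi.1] using h1
    · have : ∀ ρ : Equiv.Perm (Fin (m + 1)), i ∉ descentSet ρ := by
        intro ρ hρ
        rw [descentSet, Finset.mem_filter, Finset.mem_Icc] at hρ
        exact hi hρ.1
      simp [this]

end Statistics

/-! ### Spans of fibre sums -/

section FiberSpans

variable {n : ℕ} {κ : Type*}

theorem permSum_mem_statSpace {st : Equiv.Perm (Fin n) → κ} {p : Equiv.Perm (Fin n) → Prop}
    (h : ∀ σ τ, st σ = st τ → p σ → p τ) : permSum p ∈ statSpace st := by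
  classical
  intro σ τ hst
  rw [coeff_permSum, coeff_permSum]
  exact if_congr ⟨h σ τ hst, h τ σ hst.symm⟩ rfl rfl

theorem permSum_congr {p q : Equiv.Perm (Fin n) → Prop} (h : ∀ σ, p σ ↔ q σ) :
    permSum p = permSum q := by
  rw [funext fun σ => propext (h σ)]

theorem span_fiber_image (st : Equiv.Perm (Fin n) → κ) (K : Set κ) (hK : ∀ σ, st σ ∈ K) :
    Submodule.span ℚ ((fun k => permSum fun σ => st σ = k) '' K) = statSpace st := by
  refine span_eq_statSpace st _ ?_ fun σ => ⟨st σ, hK σ, rfl⟩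
  rintro _ ⟨k, -, rfl⟩
  exact permSum_mem_statSpace fun σ τ h hk => h ▸ hk

end FiberSpans

/-! ### The seven spaces as spaces of functions of a statistic -/

section Spaces

theorem descentSpace_eq (m : ℕ) :
    descentSpace (m + 1) = statSpace (directions : Equiv.Perm (Fin (m + 1)) → Fin m → Bool) := by
  rw [descentSpace, show descentSum (m + 1) = fun I => permSum fun σ => descentSet σ = I from rfl,
    span_fiber_image descentSet _ fun σ => Finset.filter_subset _ _]
  exact le_antisymm (statSpace_le fun σ τ => (descentSet_eq_iff σ τ).2)
    (statSpace_le fun σ τ => (descentSet_eq_iff σ τ).1)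

variable (m : ℕ)

/-- The number of alternating runs together with the direction of the first one. -/
noncomputable def signedRun {m : ℕ} (σ : Equiv.Perm (Fin (m + 2))) : ℕ × Bool :=
  (run σ, directions σ 0)

theorem run_mem_Icc {m : ℕ} (σ : Equiv.Perm (Fin (m + 2))) : run σ ∈ Set.Icc 1 (m + 1) := by
  have := numChanges_le (Fin.tail (directions σ)) (directions σ 0)
  rw [run_eq, Set.mem_Icc]
  omega

theorem runSumAsc_eq (k : ℕ) :
    runSumAsc (m + 2) k = permSum fun σ => run σ = k ∧ directions σ 0 = true :=
  permSum_congr fun σ => and_congr_right fun _ => firstRunAscending_iff σ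

theorem runSumDesc_eq (k : ℕ) :
    runSumDesc (m + 2) k = permSum fun σ => run σ = k ∧ directions σ 0 = false :=
  permSum_congr fun σ => and_congr_right fun _ => firstRunDescending_iff σ

theorem signedRunSpace_eq : signedRunSpace (m + 2) = statSpace (signedRun (m := m)) := by
  refine span_eq_statSpace _ _ ?_ fun σ => ?_
  · rintro _ (⟨k, -, rfl⟩ | ⟨k, -, rfl⟩)
    · rw [runSumAsc_eq]
      rintro σ τ h
      refine permSum_mem_statSpace (fun σ τ h => ?_) σ τ h
      obtain ⟨h1, h2⟩ := Prod.mk.inj h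
      rw [h1, h2]
      exact id
    · rw [runSumDesc_eq]
      refine permSum_mem_statSpace (fun σ τ h => ?_)
      obtain ⟨h1, h2⟩ := Prod.mk.inj h
      rw [h1, h2]
      exact id
  · cases hd : directions σ 0
    · refine Or.inr ⟨run σ, run_mem_Icc σ, ?_⟩
      rw [runSumDesc_eq]
      exact permSum_congr fun τ => by rw [signedRun, signedRun, Prod.mk.injEq, hd]
    · refine Or.inl ⟨run σ, run_mem_Icc σ, ?_⟩
      rw [runSumAsc_eq]
      exact permSum_congr fun τ => by rw [signedRun, signedRun, Prod.mk.injEq, hd]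

theorem runSpace_eq :
    runSpace (m + 2) = statSpace (run : Equiv.Perm (Fin (m + 2)) → ℕ) :=
  span_fiber_image _ _ run_mem_Icc

theorem leftRunSpace_eq :
    leftRunSpace (m + 2) = statSpace (leftRun : Equiv.Perm (Fin (m + 2)) → ℕ) :=
  span_fiber_image _ _ fun σ => by
    have := numChanges_le (directions σ) true
    rw [leftRun_eq, Set.mem_Icc]
    omega

theorem peakSpace_eq :
    peakSpace (m + 2) = statSpace (numPeaks : Equiv.Perm (Fin (m + 2)) → ℕ) :=
  span_fiber_image _ _ fun σ => by
    have := numChanges_le (directions σ) false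
    rw [numPeaks_eq, Set.mem_Icc]
    omega

theorem leftPeakSpace_eq :
    leftPeakSpace (m + 2) = statSpace (numLeftPeaks : Equiv.Perm (Fin (m + 2)) → ℕ) :=
  span_fiber_image _ _ fun σ => by
    have := numChanges_le (directions σ) true
    rw [numLeftPeaks_eq, Set.mem_Icc]
    omega

/-- The number of alternating runs, together with the direction of the first one if this number
is odd. -/
noncomputable def oddSignedRun {m : ℕ} (σ : Equiv.Perm (Fin (m + 2))) : ℕ × Bool :=
  (run σ, if Even (run σ) then true else directions σ 0)

theorem oddSignedRun_eq_iff {m : ℕ} {σ τ : Equiv.Perm (Fin (m + 2))} :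
    oddSignedRun σ = oddSignedRun τ ↔
      run σ = run τ ∧ (Odd (run τ) → directions σ 0 = directions τ 0) := by
  rw [oddSignedRun, oddSignedRun, Prod.mk.injEq]
  refine and_congr_right fun h => ?_
  rw [h, ← Nat.not_even_iff_odd]
  by_cases he : Even (run τ) <;> simp [he]

theorem cSpace_eq : cSpace (m + 2) = statSpace (oddSignedRun (m := m)) := by
  rw [cSpace, ← Submodule.span_union]
  refine span_eq_statSpace _ _ ?_ fun σ => ?_
  · rintro _ (⟨k, -, rfl⟩ | ⟨k, hk, rfl⟩ | ⟨k, hk, rfl⟩)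
    · refine permSum_mem_statSpace fun σ τ h => ?_
      rw [(oddSignedRun_eq_iff.1 h).1]
      exact id
    · simp only [runSumAsc_eq]
      refine permSum_mem_statSpace ?_
      rintro σ τ h ⟨h3, h4⟩
      obtain ⟨h1, h2⟩ := oddSignedRun_eq_iff.1 h
      rw [h1] at h3
      exact ⟨h3, (h2 (h3 ▸ ⟨k - 1, by have := hk.1; omega⟩)) ▸ h4⟩
    · simp only [runSumDesc_eq]
      refine permSum_mem_statSpace ?_
      rintro σ τ h ⟨h3, h4⟩
      obtain ⟨h1, h2⟩ := oddSignedRun_eq_iff.1 h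
      rw [h1] at h3
      exact ⟨h3, (h2 (h3 ▸ ⟨k - 1, by have := hk.1; omega⟩)) ▸ h4⟩
  · obtain ⟨hr1, hr2⟩ := run_mem_Icc σ
    rcases Nat.even_or_odd (run σ) with he | ho
    · obtain ⟨k, hk⟩ := he
      refine Or.inl ⟨k, ⟨by omega, by omega⟩, permSum_congr fun τ => ?_⟩
      rw [oddSignedRun_eq_iff, hk, two_mul]
      exact (and_iff_left fun h => absurd (Even.add_self k) (Nat.not_even_iff_odd.2 h)).symm
    · have hk : 2 * ((run σ + 1) / 2) - 1 = run σ := by obtain ⟨k, hk⟩ := ho; omega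
      have hmem : (run σ + 1) / 2 ∈ Set.Icc 1 ((m + 2) / 2) := ⟨by omega, by omega⟩
      right
      cases hd : directions σ 0
      · refine Or.inr ⟨_, hmem, ?_⟩
        simp only [runSumDesc_eq, hk]
        exact permSum_congr fun τ => by simp [oddSignedRun_eq_iff, hd, ho]
      · refine Or.inl ⟨_, hmem, ?_⟩
        simp only [runSumAsc_eq, hk]
        exact permSum_congr fun τ => by simp [oddSignedRun_eq_iff, hd, ho]

end Spaces

/-! ### The descent algebra from words with positive letters -/

section DescentAlgebra

/-- The weight of a word is `1` if the word is a rearrangement of `f`, and `0` otherwise. -/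
noncomputable def rearrangementWeight {n a : ℕ} (f w : Fin n → Fin a) : ℚ :=
  open Classical in if ∃ π : Equiv.Perm (Fin n), w ∘ π = f then 1 else 0

theorem rearrangementWeight_comp {n a : ℕ} (f w : Fin n → Fin a) (ρ : Equiv.Perm (Fin n)) :
    rearrangementWeight f (w ∘ ρ) = rearrangementWeight f w := by
  classical
  refine if_congr ⟨?_, ?_⟩ rfl rfl
  · rintro ⟨π, h⟩
    exact ⟨ρ * π, h⟩
  · rintro ⟨π, h⟩
    refine ⟨ρ⁻¹ * π, ?_⟩
    rw [← h]
    ext i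
    simp

/-- Compatible words are weakly increasing, and `f` is its own only weakly increasing rearrangement.
-/
theorem coeff_wordSum_rearrangementWeight {m a : ℕ} (f : Fin (m + 1) → Fin a) (hf : Monotone f)
    (τ : Equiv.Perm (Fin (m + 1))) :
    (wordSum (fun _ => true) (rearrangementWeight f)).coeff τ =
      if IsCompatible (fun _ => true) (directions τ) f then 1 else 0 := by
  classical
  rw [coeff_wordSum _ _ (rearrangementWeight_comp f), Finset.sum_filter,
    Finset.sum_eq_single_of_mem f (Finset.mem_univ f)]
  · have : rearrangementWeight f f = 1 := if_pos ⟨1, rfl⟩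
    rw [this]
  · intro g _ hne
    split_ifs with hg
    · refine if_neg ?_
      rintro ⟨π, h⟩
      apply hne
      have := Tuple.unique_monotone (f := g) (σ := 1) (τ := π) hg.monotone (h ▸ hf)
      rw [← h, ← this]
      rfl
    · rfl

/-- The number of descents before each position. -/
def descentsBefore {m : ℕ} (d : Fin m → Bool) (i : Fin (m + 1)) : Fin (m + 1) :=
  ⟨Finset.card {j : Fin m | j.castSucc < i ∧ d j = false}, Nat.lt_succ_of_le (card_finset_fin_le _)⟩

theorem descentsBefore_val {m : ℕ} (d : Fin m → Bool) (i : Fin (m + 1)) :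
    (descentsBefore d i : ℕ) = Finset.card {j : Fin m | j.castSucc < i ∧ d j = false} := rfl

theorem descentsBefore_monotone {m : ℕ} (d : Fin m → Bool) : Monotone (descentsBefore d) := by
  intro i j hij
  rw [Fin.le_def, descentsBefore_val, descentsBefore_val]
  refine Finset.card_le_card ?_
  intro k
  simp only [Finset.mem_filter, Finset.mem_univ, true_and]
  exact fun h => ⟨h.1.trans_le hij, h.2⟩

theorem descentsBefore_lt_iff {m : ℕ} (d : Fin m → Bool) (i : Fin m) :
    descentsBefore d i.castSucc < descentsBefore d i.succ ↔ d i = false := by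
  constructor
  · intro h
    by_contra hd
    refine h.not_ge ?_
    rw [Fin.le_def, descentsBefore_val, descentsBefore_val]
    refine Finset.card_le_card ?_
    intro k
    simp only [Finset.mem_filter, Finset.mem_univ, true_and, Fin.castSucc_lt_succ_iff,
      Fin.castSucc_lt_castSucc_iff]
    exact fun h => ⟨lt_of_le_of_ne h.1 fun hk => hd (hk ▸ h.2), h.2⟩
  · intro hd
    rw [Fin.lt_def, descentsBefore_val, descentsBefore_val]
    refine Finset.card_lt_card ?_
    rw [Finset.ssubset_iff_of_subset]
    · exact ⟨i, by simp [hd], by simp⟩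
    · intro k
      simp only [Finset.mem_filter, Finset.mem_univ, true_and, Fin.castSucc_lt_succ_iff,
        Fin.castSucc_lt_castSucc_iff]
      exact fun h => ⟨h.1.le, h.2⟩

/-- `descentsBefore d` increases exactly at the descents of `d`, so the condition says that the
descents of `d'` are among those of `d`. -/
theorem isCompatible_descentsBefore_iff {m : ℕ} (d d' : Fin m → Bool) :
    IsCompatible (fun _ => true) d' (descentsBefore d) ↔ ∀ i, d i = true → d' i = true := by
  refine forall_congr' fun i => ?_
  rw [descentsBefore_lt_iff]
  have hle := descentsBefore_monotone d (Fin.castSucc_lt_succ (i := i)).le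
  have hlt := descentsBefore_lt_iff d i
  cases hd : d i
  · simp
  · rw [hd] at hlt
    have : descentsBefore d i.castSucc = descentsBefore d i.succ :=
      hle.eq_or_lt.resolve_right fun h => Bool.noConfusion (hlt.1 h)
    simp only [this, true_and, forall_const]
    cases d' i <;> decide

/-- The sums of standardizations of words over alphabets of positive letters, for weights that
do not depend on the order of the letters. -/
def positiveWordSums (n : ℕ) : Set (PermAlg n) :=
  {x | ∃ (a : ℕ) (φ : (Fin n → Fin a) → ℚ),
    (∀ v (π : Equiv.Perm (Fin n)), φ (v ∘ π) = φ v) ∧ x = wordSum (fun _ => true) φ}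

theorem positiveWordSums_mul {n : ℕ} {x y : PermAlg n} (hx : x ∈ positiveWordSums n)
    (hy : y ∈ positiveWordSums n) : x * y ∈ positiveWordSums n := by
  obtain ⟨a, φ, hφ, rfl⟩ := hx
  obtain ⟨b, ψ, hψ, rfl⟩ := hy
  refine ⟨b * a, _, ?_, wordSum_mul _ _ _ (by simp) φ ψ hψ⟩
  intro v π
  exact congrArg₂ _ (hφ (fun i => ((twistedProdEquiv _).symm (v i)).2) π)
    (hψ (fun i => ((twistedProdEquiv _).symm (v i)).1) π)

/-- The rearrangements of `descentsBefore (directions σ)` give the sum of all permutations whose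
descent set is contained in that of `σ`; this family is triangular for the number of descents. -/
theorem span_positiveWordSums (m : ℕ) :
    Submodule.span ℚ (positiveWordSums (m + 1)) = descentSpace (m + 1) := by
  rw [descentSpace_eq]
  refine span_eq_statSpace_of_triangular _ (fun d => Finset.card {i | d i = false}) _ ?_ ?_
  · rintro _ ⟨a, φ, hφ, rfl⟩ σ τ h
    rw [coeff_wordSum _ _ hφ, coeff_wordSum _ _ hφ, h]
  · intro σ
    refine ⟨_, ⟨m + 1, rearrangementWeight (descentsBefore (directions σ)),
      rearrangementWeight_comp _, rfl⟩, ?_, ?_⟩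
    · rw [coeff_wordSum_rearrangementWeight _ (descentsBefore_monotone _), if_pos]
      · exact one_ne_zero
      · exact (isCompatible_descentsBefore_iff _ _).2 fun _ => id
    · intro τ hτ
      rw [coeff_wordSum_rearrangementWeight _ (descentsBefore_monotone _), ite_ne_right_iff,
        isCompatible_descentsBefore_iff] at hτ
      have hsub : ∀ i, directions τ i = false → directions σ i = false := fun i h => by
        by_contra hs
        rw [hτ.1 i (by simpa using hs)] at h
        exact Bool.noConfusion h
      refine or_iff_not_imp_left.2 fun hne => Finset.card_lt_card ?_
      rw [Finset.ssubset_iff_of_subset fun i => by simpa using hsub i]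
      by_contra! hcon
      refine hne (funext fun i => ?_)
      have h1 := hsub i
      have h2 := hcon i
      simp only [Finset.mem_filter, Finset.mem_univ, true_and] at h2
      revert h1 h2
      cases directions σ i <;> cases directions τ i <;> simp

end DescentAlgebra

/-! ### Spanning sets made of alternating sums -/

section AlternatingSpans

variable (m : ℕ)

theorem span_altSum_signedRun :
    Submodule.span ℚ (Set.range fun p : ℕ × Bool => altSum (m + 2) p.1 p.2) =
      signedRunSpace (m + 2) := by
  rw [signedRunSpace_eq]
  refine span_eq_statSpace_of_triangular _ Prod.fst _ ?_ ?_
  · rintro _ ⟨⟨a, s⟩, rfl⟩ σ τ h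
    obtain ⟨h1, h2⟩ := Prod.mk.inj h
    have hσ := numChanges_directions σ s
    have hτ := numChanges_directions τ s
    rw [h1, h2] at hσ
    have hc : numChanges (directions σ) s = numChanges (directions τ) s := by omega
    rw [coeff_altSum, coeff_altSum, numCompatible_congr hc]
  · intro σ
    have hσ := numChanges_directions σ (directions σ 0)
    rw [if_pos rfl] at hσ
    refine ⟨_, ⟨(run σ, directions σ 0), rfl⟩, ?_, fun τ hτ => ?_⟩
    · rw [coeff_altSum, Nat.cast_ne_zero]
      convert numCompatible_ne_zero _ _
      exact hσ.symm
    · rw [coeff_altSum, Nat.cast_ne_zero] at hτ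
      have hlt := not_le.1 (mt (numCompatible_eq_zero _ _) hτ)
      have h := numChanges_directions τ (directions σ 0)
      simp only [signedRun, Prod.mk.injEq] at hlt ⊢
      split_ifs at h with h'
      · rcases (show run τ ≤ run σ by omega).eq_or_lt with h | h
        · exact Or.inl ⟨h, h'⟩
        · exact Or.inr h
      · exact Or.inr (by omega)

theorem span_altSum_leftRun :
    Submodule.span ℚ (Set.range fun a => altSum (m + 2) a true) = leftRunSpace (m + 2) := by
  rw [leftRunSpace_eq]
  refine span_eq_statSpace_of_triangular _ id _ ?_ ?_
  · rintro _ ⟨a, rfl⟩ σ τ h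
    rw [leftRun_eq, leftRun_eq] at h
    rw [coeff_altSum, coeff_altSum, numCompatible_congr (Nat.add_left_cancel h)]
  · intro σ
    refine ⟨_, ⟨numChanges (directions σ) true + 1, rfl⟩, ?_, fun τ hτ => ?_⟩
    · rw [coeff_altSum, Nat.cast_ne_zero]
      exact numCompatible_ne_zero _ _
    · rw [coeff_altSum, Nat.cast_ne_zero] at hτ
      have hlt := not_le.1 (mt (numCompatible_eq_zero _ _) hτ)
      simp only [leftRun_eq, id]
      omega

theorem coeff_altSum_add {a : ℕ} (σ : Equiv.Perm (Fin (m + 2))) :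
    (altSum (m + 2) a true + altSum (m + 2) a false).coeff σ =
      ((numCompatible (directions σ) (directions σ 0) a +
        numCompatible (directions σ) (!directions σ 0) a : ℕ) : ℚ) := by
  rw [MonoidAlgebra.coeff_add, Finsupp.add_apply, coeff_altSum, coeff_altSum, Nat.cast_add]
  cases directions σ 0
  · exact add_comm _ _
  · rfl

/-- For the two initial signs, the numbers of changes are `run σ - 1` and `run σ`, in an order that
the sum over both signs forgets. -/
theorem coeff_altSum_add_congr {a : ℕ} {σ τ : Equiv.Perm (Fin (m + 2))} (h : run σ = run τ) :
    (altSum (m + 2) a true + altSum (m + 2) a false).coeff σ =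
      (altSum (m + 2) a true + altSum (m + 2) a false).coeff τ := by
  rw [coeff_altSum_add, coeff_altSum_add]
  have h1 := numChanges_directions σ (directions σ 0)
  have h2 := numChanges_directions τ (directions τ 0)
  have h3 := numChanges_directions σ (!directions σ 0)
  have h4 := numChanges_directions τ (!directions τ 0)
  simp only [if_true, Bool.eq_not_self, if_false] at h1 h2 h3 h4
  rw [numCompatible_congr (show numChanges (directions σ) (directions σ 0) =
      numChanges (directions τ) (directions τ 0) by omega),
    numCompatible_congr (show numChanges (directions σ) (!directions σ 0) =
      numChanges (directions τ) (!directions τ 0) by omega)]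

theorem coeff_altSum_add_run_ne_zero (σ : Equiv.Perm (Fin (m + 2))) :
    (altSum (m + 2) (run σ) true + altSum (m + 2) (run σ) false).coeff σ ≠ 0 := by
  rw [coeff_altSum_add, Nat.cast_ne_zero]
  have h := numChanges_directions σ (directions σ 0)
  rw [if_pos rfl, add_zero] at h
  have := numCompatible_ne_zero (directions σ) (directions σ 0)
  rw [h] at this
  omega

theorem run_le_of_coeff_altSum_add_ne_zero {a : ℕ} {τ : Equiv.Perm (Fin (m + 2))}
    (h : (altSum (m + 2) a true + altSum (m + 2) a false).coeff τ ≠ 0) : run τ ≤ a := by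
  by_contra! hlt
  apply h
  have h1 := numChanges_directions τ (directions τ 0)
  have h2 := numChanges_directions τ (!directions τ 0)
  simp only [if_true, Bool.eq_not_self, if_false] at h1 h2
  rw [coeff_altSum_add, numCompatible_eq_zero _ _ (by omega), numCompatible_eq_zero _ _ (by omega)]
  rfl

theorem span_altSum_run :
    Submodule.span ℚ (Set.range fun a => altSum (m + 2) a true + altSum (m + 2) a false) =
      runSpace (m + 2) := by
  rw [runSpace_eq]
  refine span_eq_statSpace_of_triangular _ id _ ?_ ?_
  · rintro _ ⟨a, rfl⟩ σ τ h
    exact coeff_altSum_add_congr m h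
  · intro σ
    refine ⟨_, ⟨run σ, rfl⟩, coeff_altSum_add_run_ne_zero m σ, fun τ hτ => ?_⟩
    exact (run_le_of_coeff_altSum_add_ne_zero m hτ).eq_or_lt

theorem span_altSum_leftPeak :
    Submodule.span ℚ (Set.range fun k => altSum (m + 2) (2 * k + 1) true) =
      leftPeakSpace (m + 2) := by
  rw [leftPeakSpace_eq]
  refine span_eq_statSpace_of_triangular _ id _ ?_ ?_
  · rintro _ ⟨k, rfl⟩ σ τ h
    rw [numLeftPeaks_eq, numLeftPeaks_eq] at h
    rw [coeff_altSum, coeff_altSum, numCompatible_congr_of_odd (odd_two_mul_add_one k) h]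
  · intro σ
    refine ⟨_, ⟨numLeftPeaks σ, rfl⟩, ?_, fun τ hτ => ?_⟩
    · rw [coeff_altSum, Nat.cast_ne_zero, numLeftPeaks_eq]
      set c := numChanges (directions σ) true with hc
      have h := numCompatible_ne_zero (directions σ) true
      rw [← hc] at h
      rcases Nat.even_or_odd c with he | ho
      · rwa [show 2 * ((c + 1) / 2) + 1 = c + 1 by obtain ⟨r, hr⟩ := he; omega]
      -- The alphabet has one letter more than the least size `c + 1` with a compatible word, but
      -- enlarging the alphabet keeps the count positive.
      · rw [show 2 * ((c + 1) / 2) + 1 = c + 1 + 1 by obtain ⟨r, hr⟩ := ho; omega]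
        have := numCompatible_le_succ (directions σ) true (c + 1)
        omega
    · rw [coeff_altSum, Nat.cast_ne_zero] at hτ
      have hlt := not_le.1 (mt (numCompatible_eq_zero _ _) hτ)
      rw [id, id, numLeftPeaks_eq τ]
      omega

theorem span_altSum_peak :
    Submodule.span ℚ (Set.range fun k => altSum (m + 2) (2 * k) false) =
      peakSpace (m + 2) := by
  rw [peakSpace_eq]
  refine span_eq_statSpace_of_triangular _ id _ ?_ ?_
  · rintro _ ⟨k, rfl⟩ σ τ h
    rw [numPeaks_eq, numPeaks_eq] at h
    rw [coeff_altSum, coeff_altSum, numCompatible_congr_of_even (even_two_mul k) h]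
  · intro σ
    -- The size `2 * (numPeaks σ + 1)` is the least even number that is at least `c + 1`.
    refine ⟨_, ⟨numPeaks σ + 1, rfl⟩, ?_, fun τ hτ => ?_⟩
    · rw [coeff_altSum, Nat.cast_ne_zero, numPeaks_eq]
      set c := numChanges (directions σ) false with hc
      have h := numCompatible_ne_zero (directions σ) false
      rw [← hc] at h
      rcases Nat.even_or_odd c with he | ho
      · rw [show 2 * (c / 2 + 1) = c + 1 + 1 by obtain ⟨r, hr⟩ := he; omega]
        have := numCompatible_le_succ (directions σ) false (c + 1)
        omega
      · rwa [show 2 * (c / 2 + 1) = c + 1 by obtain ⟨r, hr⟩ := ho; omega]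
    · rw [coeff_altSum, Nat.cast_ne_zero] at hτ
      have hlt := not_le.1 (mt (numCompatible_eq_zero _ _) hτ)
      rw [id, id, numPeaks_eq τ]
      omega

/-- A spanning set of `cSpace`. -/
def oddAltSums (n : ℕ) : Set (PermAlg n) :=
  {x | ∃ a s, Odd a ∧ x = altSum n a s} ∪
    {x | ∃ a, Even a ∧ x = altSum n a true + altSum n a false}

theorem span_oddAltSums : Submodule.span ℚ (oddAltSums (m + 2)) = cSpace (m + 2) := by
  rw [cSpace_eq]
  refine span_eq_statSpace_of_triangular _ Prod.fst _ ?_ ?_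
  · rintro _ (⟨a, s, ha, rfl⟩ | ⟨a, -, rfl⟩) σ τ h
    · obtain ⟨h1, h2⟩ := oddSignedRun_eq_iff.1 h
      have hσ := numChanges_directions σ s
      have hτ := numChanges_directions τ s
      -- If the number of runs `r` is even, `c` is `r - 1` or `r` according to the first direction,
      -- and `⌈c/2⌉ = r/2` in both cases: odd alphabets do not see that direction.
      have hc : (numChanges (directions σ) s + 1) / 2 = (numChanges (directions τ) s + 1) / 2 := by
        rcases Nat.even_or_odd (run τ) with he | ho
        · obtain ⟨r, hr⟩ := he
          split_ifs at hσ hτ <;> omega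
        · rw [h2 ho] at hσ
          omega
      rw [coeff_altSum, coeff_altSum, numCompatible_congr_of_odd ha hc]
    · exact coeff_altSum_add_congr m (oddSignedRun_eq_iff.1 h).1
  · intro σ
    rcases Nat.even_or_odd (run σ) with he | ho
    · refine ⟨_, Or.inr ⟨run σ, he, rfl⟩, coeff_altSum_add_run_ne_zero m σ, fun τ hτ => ?_⟩
      rcases (run_le_of_coeff_altSum_add_ne_zero m hτ).eq_or_lt with h | h
      · exact Or.inl (oddSignedRun_eq_iff.2 ⟨h, fun ho => absurd he (Nat.not_even_iff_odd.2 ho)⟩)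
      · exact Or.inr h
    · have hσ := numChanges_directions σ (directions σ 0)
      rw [if_pos rfl] at hσ
      refine ⟨_, Or.inl ⟨run σ, directions σ 0, ho, rfl⟩, ?_, fun τ hτ => ?_⟩
      · rw [coeff_altSum, Nat.cast_ne_zero]
        convert numCompatible_ne_zero _ _
        exact hσ.symm
      · rw [coeff_altSum, Nat.cast_ne_zero] at hτ
        have hlt := not_le.1 (mt (numCompatible_eq_zero _ _) hτ)
        have h := numChanges_directions τ (directions σ 0)
        rw [oddSignedRun_eq_iff]
        simp only [oddSignedRun]
        split_ifs at h with h'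
        · rcases (show run τ ≤ run σ by omega).eq_or_lt with h | h
          · exact Or.inl ⟨h, fun _ => h'⟩
          · exact Or.inr h
        · exact Or.inr (by omega)

end AlternatingSpans

/-! ### Inclusions, units and closure under multiplication -/

section Subspaces

variable (m : ℕ)

theorem signedRunSpace_le_descentSpace : signedRunSpace (m + 2) ≤ descentSpace (m + 2) := by
  rw [signedRunSpace_eq, descentSpace_eq]
  exact statSpace_le fun σ τ h => by rw [signedRun, signedRun, run_eq, run_eq, h]

theorem runSpace_le_signedRunSpace : runSpace (m + 2) ≤ signedRunSpace (m + 2) := by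
  rw [runSpace_eq, signedRunSpace_eq]
  exact statSpace_le fun σ τ h => (Prod.mk.inj h).1

theorem leftRunSpace_le_signedRunSpace : leftRunSpace (m + 2) ≤ signedRunSpace (m + 2) := by
  rw [← span_altSum_leftRun, ← span_altSum_signedRun]
  refine Submodule.span_mono ?_
  rintro _ ⟨a, rfl⟩
  exact ⟨(a, true), rfl⟩

theorem cSpace_le_signedRunSpace : cSpace (m + 2) ≤ signedRunSpace (m + 2) := by
  rw [cSpace_eq, signedRunSpace_eq]
  exact statSpace_le fun σ τ h =>
    oddSignedRun_eq_iff.2 ⟨(Prod.mk.inj h).1, fun _ => (Prod.mk.inj h).2⟩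

theorem peakSpace_le_signedRunSpace : peakSpace (m + 2) ≤ signedRunSpace (m + 2) := by
  rw [← span_altSum_peak, ← span_altSum_signedRun]
  refine Submodule.span_mono ?_
  rintro _ ⟨k, rfl⟩
  exact ⟨(2 * k, false), rfl⟩

theorem leftPeakSpace_le_signedRunSpace : leftPeakSpace (m + 2) ≤ signedRunSpace (m + 2) := by
  rw [← span_altSum_leftPeak, ← span_altSum_signedRun]
  refine Submodule.span_mono ?_
  rintro _ ⟨k, rfl⟩
  exact ⟨(2 * k + 1, true), rfl⟩

theorem one_mem_leftPeakSpace : 1 ∈ leftPeakSpace (m + 2) := by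
  rw [← span_altSum_leftPeak, ← altSum_one]
  exact Submodule.subset_span ⟨0, rfl⟩

theorem one_mem_signedRunSpace : 1 ∈ signedRunSpace (m + 2) :=
  leftPeakSpace_le_signedRunSpace m (one_mem_leftPeakSpace m)

theorem one_mem_leftRunSpace : 1 ∈ leftRunSpace (m + 2) := by
  rw [← span_altSum_leftRun, ← altSum_one]
  exact Submodule.subset_span ⟨1, rfl⟩

theorem one_mem_cSpace : 1 ∈ cSpace (m + 2) := by
  rw [← span_oddAltSums, ← altSum_one]
  exact Submodule.subset_span (Or.inl ⟨1, true, odd_one, rfl⟩)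

theorem mul_mem_descentSpace {x y : PermAlg (m + 2)} (hx : x ∈ descentSpace (m + 2))
    (hy : y ∈ descentSpace (m + 2)) : x * y ∈ descentSpace (m + 2) := by
  rw [← span_positiveWordSums] at *
  exact mul_mem_span (fun x hx y hy => Submodule.subset_span (positiveWordSums_mul hx hy)) hx hy

theorem mul_mem_signedRunSpace {x y : PermAlg (m + 2)} (hx : x ∈ signedRunSpace (m + 2))
    (hy : y ∈ signedRunSpace (m + 2)) : x * y ∈ signedRunSpace (m + 2) := by
  rw [← span_altSum_signedRun] at *
  refine mul_mem_span ?_ hx hy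
  rintro _ ⟨⟨a, s⟩, rfl⟩ _ ⟨⟨b, t⟩, rfl⟩
  exact Submodule.subset_span ⟨(_, _), (altSum_mul _ a b s t).symm⟩

theorem mul_mem_leftRunSpace {x y : PermAlg (m + 2)} (hx : x ∈ leftRunSpace (m + 2))
    (hy : y ∈ leftRunSpace (m + 2)) : x * y ∈ leftRunSpace (m + 2) := by
  rw [← span_altSum_leftRun] at *
  refine mul_mem_span ?_ hx hy
  rintro _ ⟨a, rfl⟩ _ ⟨b, rfl⟩
  refine Submodule.subset_span ⟨b * a, ?_⟩
  simp [altSum_mul]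

theorem mul_mem_peakSpace {x y : PermAlg (m + 2)} (hx : x ∈ peakSpace (m + 2))
    (hy : y ∈ peakSpace (m + 2)) : x * y ∈ peakSpace (m + 2) := by
  rw [← span_altSum_peak] at *
  refine mul_mem_span ?_ hx hy
  rintro _ ⟨a, rfl⟩ _ ⟨b, rfl⟩
  refine Submodule.subset_span ⟨2 * b * a, ?_⟩
  simp [altSum_mul, mul_left_comm, mul_assoc]

theorem mul_mem_leftPeakSpace {x y : PermAlg (m + 2)} (hx : x ∈ leftPeakSpace (m + 2))
    (hy : y ∈ leftPeakSpace (m + 2)) : x * y ∈ leftPeakSpace (m + 2) := by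
  rw [← span_altSum_leftPeak] at *
  refine mul_mem_span ?_ hx hy
  rintro _ ⟨a, rfl⟩ _ ⟨b, rfl⟩
  refine Submodule.subset_span ⟨2 * a * b + a + b, ?_⟩
  simp only [altSum_mul, beq_self_eq_true, ite_self]
  congr 1
  ring

theorem altSum_add_mul_of_even (n a b : ℕ) (ha : Even a) (t : Bool) :
    (altSum n a true + altSum n a false) * altSum n b t =
      altSum n (b * a) true + altSum n (b * a) false := by
  simp [add_mul, altSum_mul, ha]

theorem altSum_add_mul_of_odd (n a b : ℕ) (ha : Odd a) (t : Bool) :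
    (altSum n a true + altSum n a false) * altSum n b t =
      altSum n (b * a) true + altSum n (b * a) false := by
  cases t <;> simp [add_mul, altSum_mul, Nat.not_even_iff_odd.2 ha, add_comm]

/-- For odd `a`, multiplying by `altSum n b t` keeps or exchanges the two initial signs; for even
`a` it keeps both. The sum over both signs is preserved either way. -/
theorem altSum_add_mul (n a b : ℕ) (t : Bool) :
    (altSum n a true + altSum n a false) * altSum n b t =
      altSum n (b * a) true + altSum n (b * a) false :=
  (Nat.even_or_odd a).elim (altSum_add_mul_of_even n a b · t) (altSum_add_mul_of_odd n a b · t)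

theorem mul_altSum_add_of_odd (n a b : ℕ) (ha : Odd a) (s : Bool) :
    altSum n a s * (altSum n b true + altSum n b false) =
      altSum n (b * a) true + altSum n (b * a) false := by
  cases s <;> simp [mul_add, altSum_mul, Nat.not_even_iff_odd.2 ha, add_comm]

theorem mul_mem_runSpace {x y : PermAlg (m + 2)} (hx : x ∈ runSpace (m + 2))
    (hy : y ∈ runSpace (m + 2)) : x * y ∈ runSpace (m + 2) := by
  rw [← span_altSum_run] at *
  refine mul_mem_span ?_ hx hy
  rintro _ ⟨a, rfl⟩ _ ⟨b, rfl⟩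
  rw [mul_add, altSum_add_mul, altSum_add_mul]
  exact Submodule.add_mem _ (Submodule.subset_span ⟨b * a, rfl⟩)
    (Submodule.subset_span ⟨b * a, rfl⟩)

theorem mul_mem_cSpace {x y : PermAlg (m + 2)} (hx : x ∈ cSpace (m + 2))
    (hy : y ∈ cSpace (m + 2)) : x * y ∈ cSpace (m + 2) := by
  rw [← span_oddAltSums] at *
  refine mul_mem_span ?_ hx hy
  rintro _ (⟨a, s, ha, rfl⟩ | ⟨a, ha, rfl⟩) _ (⟨b, t, hb, rfl⟩ | ⟨b, hb, rfl⟩)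
  · exact Submodule.subset_span (Or.inl ⟨b * a, _, hb.mul ha, altSum_mul _ _ _ _ _⟩)
  · exact Submodule.subset_span
      (Or.inr ⟨b * a, hb.mul_right a, mul_altSum_add_of_odd _ _ _ ha _⟩)
  · exact Submodule.subset_span (Or.inr ⟨b * a, ha.mul_left b, altSum_add_mul _ _ _ _⟩)
  · rw [mul_add, altSum_add_mul, altSum_add_mul]
    have : altSum (m + 2) (b * a) true + altSum (m + 2) (b * a) false ∈ oddAltSums (m + 2) :=
      Or.inr ⟨b * a, ha.mul_left b, rfl⟩
    exact Submodule.add_mem _ (Submodule.subset_span this) (Submodule.subset_span this)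

end Subspaces

theorem mainTheorem1 (n : ℕ) (hn : 2 ≤ n) :
    ∃ (D Wpm Wo C Po : Subalgebra ℚ (PermAlg n)) (W P : NonUnitalSubalgebra ℚ (PermAlg n)),
      (Subalgebra.toSubmodule D = descentSpace n ∧
        Subalgebra.toSubmodule Wpm = signedRunSpace n ∧
        W.toSubmodule = runSpace n ∧
        Subalgebra.toSubmodule Wo = leftRunSpace n ∧
        Subalgebra.toSubmodule C = cSpace n ∧
        P.toSubmodule = peakSpace n ∧
        Subalgebra.toSubmodule Po = leftPeakSpace n) ∧
      Wpm ≤ D ∧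
      W ≤ Wpm.toNonUnitalSubalgebra ∧
      Wo ≤ Wpm ∧
      C ≤ Wpm ∧
      P ≤ Wpm.toNonUnitalSubalgebra ∧
      Po ≤ Wpm := by
  obtain ⟨m, rfl⟩ := Nat.exists_eq_add_of_le' hn
  exact ⟨(descentSpace (m + 2)).toSubalgebra
      (signedRunSpace_le_descentSpace m (one_mem_signedRunSpace m))
      fun _ _ => mul_mem_descentSpace m,
    (signedRunSpace (m + 2)).toSubalgebra (one_mem_signedRunSpace m)
      fun _ _ => mul_mem_signedRunSpace m,
    (leftRunSpace (m + 2)).toSubalgebra (one_mem_leftRunSpace m)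
      fun _ _ => mul_mem_leftRunSpace m,
    (cSpace (m + 2)).toSubalgebra (one_mem_cSpace m) fun _ _ => mul_mem_cSpace m,
    (leftPeakSpace (m + 2)).toSubalgebra (one_mem_leftPeakSpace m)
      fun _ _ => mul_mem_leftPeakSpace m,
    { runSpace (m + 2) with mul_mem' := mul_mem_runSpace m },
    { peakSpace (m + 2) with mul_mem' := mul_mem_peakSpace m },
    ⟨rfl, rfl, rfl, rfl, rfl, rfl, rfl⟩,
    signedRunSpace_le_descentSpace m, runSpace_le_signedRunSpace m,
    leftRunSpace_le_signedRunSpace m, cSpace_le_signedRunSpace m,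
    peakSpace_le_signedRunSpace m, leftPeakSpace_le_signedRunSpace m⟩
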